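/- For a finite Borel measure $\mu$ on $\mathbb R$ put $U_\mu(x)=\int\log|x-z|\,d\mu(z)$ and $I(\mu)=\iint\log|x_1-x_2|\,d\mu(x_1)\,d\mu(x_2)$, with $\log 0=-\infty$. For a finite set $A\subset\mathbb R[x]$ let $$\lambda_A=\inf_\mu\int x\,d\mu(x),$$ where $\mu$ ranges over the Borel probability measures supported on $[0,\infty)$ with $I(\mu)\ge 0$ and $\int\log|Q|\,d\mu\ge 0$ for every $Q\in A$ (call these measures feasible). An optimal measure for $A$ is a probability measure $\mu$ supported on a finite union $\Sigma\subset[0,18]$ of compact intervals such that $\int x\,d\mu=\lambda_A$, $I(\mu)=0$, and, for some scalars $\lambda_Q\ge 0$ ($Q\in A$) and $\lambda_0>0$, $$x\ \ge\ \lambda_A+\sum_{Q\in A}\lambda_Q\log|Q(x)|+\lambda_0U_\mu(x)\qquad\text{for all }x\ge 0,$$ with equality for every $x\in\Sigma$, and $\int\log|Q|\,d\mu=0$ whenever $\lambda_Q\ne 0$. The equation $$(1+\nu)\log(1+\nu^{-1})+\frac{\log\nu}{1+\nu}=1$$ has exactly one positive root $\nu$. Let $A=\{x\}$. Then $$\lambda_A=e(1+\nu^{-1})^{-\nu}=1.7336105\dots,$$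 that is, $1.7336105\le\lambda_A<1.7336106$. Moreover, there is exactly one optimal measure $\mu_A$ for $A$, it is also the only feasible measure with mean $\lambda_A$, and $$d\mu_A(x)=\frac{2\sqrt{(b-x)(x-a)}}{\pi\,(a+b-2\sqrt{ab})\,x}\,dx\quad\text{on }[a,b],$$ where $$a=e(1+\nu^{-1})^{-\nu}\Bigl(1-\frac1{\sqrt{\nu+1}}\Bigr)^2,\qquad b=e(1+\nu^{-1})^{-\nu}\Bigl(1+\frac1{\sqrt{\nu+1}}\Bigr)^2.$$ -/

import Mathlib

open MeasureTheory Polynomial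
open scoped ENNReal

noncomputable section

/-- The integral of an extended-real valued function, `∫ f⁺ - ∫ f⁻`, with values in `[-∞, ∞]`.
If both parts are infinite (the integral is undefined) the value is `⊤ - ⊤ = ⊥`; for the
logarithmic integrals below this can only happen for measures with infinite mean. -/
def extIntegral {α : Type*} [MeasurableSpace α] (μ : Measure α) (f : α → EReal) : EReal :=
  ((∫⁻ x, (f x).toENNReal ∂μ : ℝ≥0∞) : EReal) - ((∫⁻ x, (-f x).toENNReal ∂μ : ℝ≥0∞) : EReal)

/-- `log |t|` as an extended real number, so that `log |0| = -∞`. -/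
def extLogAbs (t : ℝ) : EReal := ENNReal.log ‖t‖ₑ

/-- The logarithmic potential `U_μ(x) = ∫ log |x - z| dμ(z)`. -/
def logPotential (μ : Measure ℝ) (x : ℝ) : EReal :=
  extIntegral μ fun z => extLogAbs (x - z)

/-- The logarithmic energy `I(μ) = ∫ log |x₁ - x₂| dμ(x₁) dμ(x₂)`. -/
def logEnergy (μ : Measure ℝ) : EReal :=
  extIntegral (μ.prod μ) fun p => extLogAbs (p.1 - p.2)

/-- `∫ log |Q(x)| dμ(x)`. -/
def logIntegral (μ : Measure ℝ) (Q : ℝ[X]) : EReal :=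
  extIntegral μ fun x => extLogAbs (Q.eval x)

/-- The mean `∫ x dμ(x) ∈ [0, ∞]` of a measure supported on the nonnegative reals. -/
def meanValue (μ : Measure ℝ) : ℝ≥0∞ := ∫⁻ x, ENNReal.ofReal x ∂μ

/-- The probability measures on the nonnegative reals over which the mean is minimized. -/
structure IsFeasible (A : Finset ℝ[X]) (μ : Measure ℝ) : Prop where
  isProbability : IsProbabilityMeasure μ
  nonneg_support : μ (Set.Iio 0) = 0
  energy_nonneg : 0 ≤ logEnergy μ
  logIntegral_nonneg : ∀ Q ∈ A, 0 ≤ logIntegral μ Q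

/-- `λ_A = inf ∫ x dμ(x)`, over all feasible `μ`. -/
def traceBound (A : Finset ℝ[X]) : ℝ≥0∞ :=
  ⨅ (μ : Measure ℝ) (_ : IsFeasible A μ), meanValue μ

/-- `S` is a finite union of (nondegenerate) compact intervals. -/
def IsFiniteUnionOfIntervals (S : Set ℝ) : Prop :=
  ∃ F : Finset (ℝ × ℝ), (∀ p ∈ F, p.1 < p.2) ∧ S = ⋃ p ∈ F, Set.Icc p.1 p.2

/-- The conditions that determine the optimal measure `μ_A`: it is a probability measure
supported on a finite union `S ⊆ [0, 18]` of intervals, with mean `λ_A` and energy `0`, and there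
are scalars `λ_Q ≥ 0` and `λ_0 > 0` with
`x ≥ λ_A + ∑ λ_Q log |Q(x)| + λ_0 U_μ(x)` for all `x ≥ 0`, with equality on `S`, and
`∫ log |Q| dμ = 0` whenever `λ_Q ≠ 0`. -/
def IsOptimalMeasure (A : Finset ℝ[X]) (μ : Measure ℝ) : Prop :=
  IsProbabilityMeasure μ ∧
  ∃ S : Set ℝ, IsFiniteUnionOfIntervals S ∧ S ⊆ Set.Icc 0 18 ∧ μ Sᶜ = 0 ∧
    meanValue μ = traceBound A ∧
    logEnergy μ = 0 ∧
    ∃ (c : ℝ[X] → ℝ) (c₀ : ℝ), (∀ Q ∈ A, 0 ≤ c Q) ∧ 0 < c₀ ∧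
      (∀ x : ℝ, 0 ≤ x →
        (traceBound A : EReal) + ∑ Q ∈ A, (c Q : EReal) * extLogAbs (Q.eval x)
          + (c₀ : EReal) * logPotential μ x ≤ (x : EReal)) ∧
      (∀ x ∈ S,
        (traceBound A : EReal) + ∑ Q ∈ A, (c Q : EReal) * extLogAbs (Q.eval x)
          + (c₀ : EReal) * logPotential μ x = (x : EReal)) ∧
      (∀ Q ∈ A, c Q ≠ 0 → logIntegral μ Q = 0)

/-- The measure `2 √((b - x)(x - a)) / (π (a + b - 2 √(a b)) x) dx` on `[a, b]`. -/
def siegelMeasure (a b : ℝ) : Measure ℝ :=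
  (volume.restrict (Set.Icc a b)).withDensity fun x =>
    ENNReal.ofReal
      (2 * Real.sqrt ((b - x) * (x - a)) / (Real.pi * (a + b - 2 * Real.sqrt (a * b)) * x))

/-- The equation `(1 + ν) log (1 + ν⁻¹) + log ν / (1 + ν) = 1` for a positive real `ν`. -/
def IsSiegelRoot (ν : ℝ) : Prop :=
  0 < ν ∧ (1 + ν) * Real.log (1 + ν⁻¹) + Real.log ν / (1 + ν) = 1

end

/-!
With `λ = 1 / (ν + 1)` and `r = √λ`, the measure in question is the Marchenko-Pastur law of ratio
`λ` and scale `T`, and the theorem is linear programming duality with that law as its own dual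
certificate.

*The potential.* Write points of the support as `T |1 + r e^{iθ}|²`. The law becomes the weight
`sin² θ / |1 + r e^{iθ}|²`, a combination of `1`, `cos θ` and the Poisson kernel at `-r`
(`siegelWeight_eq`), so that Cauchy's and Poisson's formulas, extended to the closed disc by
dominated convergence, give the potential in closed form at `x = T (1 + r² + r (w + 1 / w))`,
`|w| ≤ 1` (`integral_log_sub_siegelMeasure`). On the support, where `|w| = 1`, it is an affine
combination of `x` and `log x`. Off the support `w` is real, and the excess, which vanishes at
`w = ±1`, is monotone in `w` on either side. This yields
`x ≥ T + T (1 - r²) log x + 2 r² T U(x)` with equality on the support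
(`siegelMeasure_inequality`, `siegelMeasure_equality`), as soon as `T` and `r` satisfy
`(1 + r²) log T + 2 r² log r = r²`. The formula for `T` says that `∫ log x` vanishes, and Siegel's
equation then amounts to this relation. Integrating the equality shows that the energy vanishes.

*Energy.* For `u ≠ 0`, `-log |u| = ∫₀^∞ ((r - |u|)⁺ - (r - 1)⁺) r⁻² dr`, and the tent function
`(r - |x - y|)⁺` is the correlation of windows `(s, s + r]`. Hence for probability measures
`2 I(μ, ν) - I(μ) - I(ν) = ∫₀^∞ r⁻² ∫ (μ(s, s + r] - ν(s, s + r])² ds dr ≥ 0`, and equality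
forces `μ = ν` (`log_energy_le`).

*Conclusion.* Integrating the pointwise inequality against a feasible `μ` bounds its mean below by
`T + 2 r² T I(μ, σ)`, where `σ` is Siegel's measure, and `2 I(μ, σ) ≥ I(μ) + I(σ) ≥ 0`, with
equality only for `μ = σ` (`SiegelParameters.le_meanValue`). Conversely, integrating the inequality
that an optimal measure satisfies against `σ` gives `I(μ, σ) ≤ 0`, so again `μ = σ`
(`SiegelParameters.eq_of_isOptimalMeasure`). The decimals of `T` come from bracketing the root of
Siegel's equation between two rationals.
-/

noncomputable section

open Set Filter Topology

/-! ### Negative definiteness of the logarithmic kernel -/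

/-- The integrand vanishes on `(0, p]`, is `(r - p) / r²` on `(p, q]` and `(q - p) / r²` beyond. -/
theorem integrableOn_tent_sub_tent {p q : ℝ} (hp : 0 < p) (hpq : p ≤ q) :
    IntegrableOn (fun r : ℝ => (max (r - p) 0 - max (r - q) 0) / r ^ 2) (Ioi 0) ∧
      ∫ r in Ioi (0 : ℝ), (max (r - p) 0 - max (r - q) 0) / r ^ 2 = Real.log q - Real.log p := by
  have hq : 0 < q := hp.trans_le hpq
  have hd1 : ∀ r ∈ Icc p q, HasDerivAt (fun r : ℝ => Real.log r + p / r) ((r - p) / r ^ 2) r := by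
    intro r hr
    have hr0 : r ≠ 0 := (hp.trans_le hr.1).ne'
    have h := (Real.hasDerivAt_log hr0).add ((hasDerivAt_inv hr0).const_mul p)
    simp only [← div_eq_mul_inv] at h
    refine h.congr_deriv ?_
    field_simp
    ring
  have hc1 : ContinuousOn (fun r : ℝ => (r - p) / r ^ 2) (uIcc p q) := by
    rw [uIcc_of_le hpq]
    refine ContinuousOn.div (by fun_prop) (by fun_prop) fun r hr => ?_
    have : 0 < r := hp.trans_le hr.1
    positivity
  have hi1 := intervalIntegral.integral_eq_sub_of_hasDerivAt
    (by rw [uIcc_of_le hpq]; exact hd1) hc1.intervalIntegrable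
  have hi1' := hc1.intervalIntegrable (μ := volume)
  rw [intervalIntegral.integral_of_le hpq] at hi1
  rw [intervalIntegrable_iff_integrableOn_Ioc_of_le hpq] at hi1'
  have hd2 : ∀ r ∈ Ici q, HasDerivAt (fun r : ℝ => -((q - p) / r)) ((q - p) / r ^ 2) r := by
    intro r hr
    have hr0 : r ≠ 0 := (hq.trans_le hr).ne'
    have h := ((hasDerivAt_inv hr0).const_mul (q - p)).neg
    simp only [← div_eq_mul_inv] at h
    refine h.congr_deriv ?_
    field_simp
  have ht2 : Tendsto (fun r : ℝ => -((q - p) / r)) atTop (𝓝 0) := by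
    simpa using (tendsto_const_nhds.div_atTop tendsto_id :
      Tendsto (fun r : ℝ => (q - p) / r) atTop (𝓝 0)).neg
  have hn2 : ∀ r ∈ Ioi q, 0 ≤ (q - p) / r ^ 2 := fun r hr =>
    div_nonneg (sub_nonneg.2 hpq) (sq_nonneg r)
  have hi2' := integrableOn_Ioi_deriv_of_nonneg' hd2 hn2 ht2
  have hi2 := integral_Ioi_of_hasDerivAt_of_nonneg' hd2 hn2 ht2
  have e0 : EqOn (fun r : ℝ => (max (r - p) 0 - max (r - q) 0) / r ^ 2) (fun _ => 0) (Ioc 0 p) := by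
    intro r hr
    have h1 : r - p ≤ 0 := by linarith [hr.2]
    have h2 : r - q ≤ 0 := by linarith [hr.2]
    simp [max_eq_right h1, max_eq_right h2]
  have e1 : EqOn (fun r : ℝ => (max (r - p) 0 - max (r - q) 0) / r ^ 2)
      (fun r => (r - p) / r ^ 2) (Ioc p q) := by
    intro r hr
    have h1 : 0 ≤ r - p := by linarith [hr.1]
    have h2 : r - q ≤ 0 := by linarith [hr.2]
    simp [max_eq_left h1, max_eq_right h2]
  have e2 : EqOn (fun r : ℝ => (max (r - p) 0 - max (r - q) 0) / r ^ 2)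
      (fun r => (q - p) / r ^ 2) (Ioi q) := by
    intro r hr
    have h2 : 0 ≤ r - q := by linarith [mem_Ioi.1 hr]
    have h1 : 0 ≤ r - p := by linarith
    simp [max_eq_left h1, max_eq_left h2]
  have j0 := (integrableOn_congr_fun e0 measurableSet_Ioc (μ := volume)).2 integrableOn_zero
  have j1 := (integrableOn_congr_fun e1 measurableSet_Ioc (μ := volume)).2 hi1'
  have j2 := (integrableOn_congr_fun e2 measurableSet_Ioi (μ := volume)).2 hi2'
  have j12 : IntegrableOn (fun r : ℝ => (max (r - p) 0 - max (r - q) 0) / r ^ 2) (Ioi p) := by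
    rw [← Ioc_union_Ioi_eq_Ioi hpq]; exact j1.union j2
  refine ⟨by rw [← Ioc_union_Ioi_eq_Ioi hp.le]; exact j0.union j12, ?_⟩
  rw [← Ioc_union_Ioi_eq_Ioi hp.le,
    setIntegral_union Ioc_disjoint_Ioi_same measurableSet_Ioi j0 j12,
    ← Ioc_union_Ioi_eq_Ioi hpq, setIntegral_union Ioc_disjoint_Ioi_same measurableSet_Ioi j1 j2,
    setIntegral_congr_fun measurableSet_Ioc e0, setIntegral_congr_fun measurableSet_Ioc e1,
    setIntegral_congr_fun measurableSet_Ioi e2, hi1, hi2]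
  simp
  field_simp
  ring

/-- The kernel that represents `-log |u|` as a superposition of the positive definite tent functions
`u ↦ (r - |u|)⁺`, see `integral_tentKernel`. -/
def tentKernel (u r : ℝ) : ℝ := (max (r - |u|) 0 - max (r - 1) 0) / r ^ 2

theorem measurable_tentKernel : Measurable fun p : ℝ × ℝ => tentKernel p.1 p.2 := by
  unfold tentKernel
  fun_prop

theorem integral_tentKernel {u : ℝ} (hu : u ≠ 0) :
    IntegrableOn (tentKernel u) (Ioi 0) ∧
      ∫ r in Ioi (0 : ℝ), tentKernel u r = -Real.log |u| ∧
      ∫ r in Ioi (0 : ℝ), ‖tentKernel u r‖ = |Real.log (|u|)| := by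
  have hu' : 0 < |u| := abs_pos.2 hu
  rcases le_total |u| 1 with h | h
  · obtain ⟨h1, h2⟩ := integrableOn_tent_sub_tent hu' h
    have hn : ∀ r, ‖tentKernel u r‖ = tentKernel u r := fun r => by
      refine Real.norm_of_nonneg (div_nonneg (sub_nonneg.2 ?_) (sq_nonneg r))
      exact max_le_max (by linarith) le_rfl
    simp only [hn]
    have h3 : ∫ r in Ioi (0 : ℝ), tentKernel u r = -Real.log |u| := by
      unfold tentKernel; rw [h2]; simp
    refine ⟨h1, h3, ?_⟩
    rw [h3, abs_of_nonpos (Real.log_nonpos hu'.le h)]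
  · obtain ⟨h1, h2⟩ := integrableOn_tent_sub_tent one_pos h
    have e : ∀ r, tentKernel u r = -((max (r - 1) 0 - max (r - |u|) 0) / r ^ 2) := fun r => by
      unfold tentKernel; ring
    have hn : ∀ r, ‖tentKernel u r‖ = (max (r - 1) 0 - max (r - |u|) 0) / r ^ 2 := fun r => by
      rw [e, norm_neg]
      refine Real.norm_of_nonneg (div_nonneg (sub_nonneg.2 ?_) (sq_nonneg r))
      exact max_le_max (by linarith) le_rfl
    simp only [hn]
    refine ⟨?_, ?_, ?_⟩
    · rw [show tentKernel u = _ from funext e]; exact h1.neg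
    · rw [show tentKernel u = _ from funext e, integral_neg, h2]; simp
    · rw [h2, abs_of_nonneg (Real.log_nonneg h)]; simp

/-- The tent function is the length of the set of `s` for which `(s, s + r]` contains both
points. -/
theorem lintegral_tent (μ ν : Measure ℝ) [IsProbabilityMeasure μ] [IsProbabilityMeasure ν]
    (r : ℝ) :
    ∫⁻ p, ENNReal.ofReal (max (r - |p.1 - p.2|) 0) ∂(μ.prod ν) =
      ∫⁻ s, μ (Ioc s (s + r)) * ν (Ioc s (s + r)) := by
  have hS : MeasurableSet {q : (ℝ × ℝ) × ℝ |
      (q.2 < q.1.1 ∧ q.1.1 ≤ q.2 + r) ∧ (q.2 < q.1.2 ∧ q.1.2 ≤ q.2 + r)} := by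
    measurability
  have e1 : ∀ p : ℝ × ℝ, ENNReal.ofReal (max (r - |p.1 - p.2|) 0) =
      ∫⁻ s, {q : (ℝ × ℝ) × ℝ | (q.2 < q.1.1 ∧ q.1.1 ≤ q.2 + r) ∧
        (q.2 < q.1.2 ∧ q.1.2 ≤ q.2 + r)}.indicator 1 (p, s) := by
    intro p
    have : ∀ s, {q : (ℝ × ℝ) × ℝ | (q.2 < q.1.1 ∧ q.1.1 ≤ q.2 + r) ∧
        (q.2 < q.1.2 ∧ q.1.2 ≤ q.2 + r)}.indicator (1 : (ℝ × ℝ) × ℝ → ℝ≥0∞) (p, s) =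
        (Ico (max p.1 p.2 - r) (min p.1 p.2)).indicator 1 s := by
      intro s
      simp only [indicator, mem_ofPred_eq, mem_Ico, Pi.one_apply]
      congr 1
      simp only [lt_min_iff, sub_le_iff_le_add, max_le_iff, eq_iff_iff]
      tauto
    simp only [this]
    rw [lintegral_indicator_one measurableSet_Ico, Real.volume_Ico]
    have : min p.1 p.2 - (max p.1 p.2 - r) = r - |p.1 - p.2| := by
      rw [abs_sub_comm, ← max_sub_min_eq_abs]; ring
    rw [this]
    rcases le_total (r - |p.1 - p.2|) 0 with h | h
    · rw [max_eq_right h, ENNReal.ofReal_of_nonpos h]; simp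
    · rw [max_eq_left h]
  simp only [e1]
  rw [lintegral_lintegral_swap (f := fun p s => {q : (ℝ × ℝ) × ℝ |
    (q.2 < q.1.1 ∧ q.1.1 ≤ q.2 + r) ∧ (q.2 < q.1.2 ∧ q.1.2 ≤ q.2 + r)}.indicator 1 (p, s))
    (measurable_one.indicator hS).aemeasurable]
  refine lintegral_congr fun s => ?_
  rw [← Measure.prod_prod, ← lintegral_indicator_one (measurableSet_Ioc.prod measurableSet_Ioc)]
  rfl

/-- `∫ μ (s, s + r] ν (s, s + r] ds`, the integral of the tent function `(r - |x - y|)⁺` against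
`μ × ν`. -/
def windowCorrelation (μ ν : Measure ℝ) (r : ℝ) : ℝ :=
  ∫ s, μ.real (Ioc s (s + r)) * ν.real (Ioc s (s + r))

theorem measurable_measure_Ioc_add (μ : Measure ℝ) [IsProbabilityMeasure μ] (r : ℝ) :
    Measurable fun s => μ (Ioc s (s + r)) := by
  have hS : MeasurableSet {q : ℝ × ℝ | q.1 < q.2 ∧ q.2 ≤ q.1 + r} := by measurability
  exact measurable_measure_prodMk_left hS

theorem integrable_tent (μ ν : Measure ℝ) [IsProbabilityMeasure μ] [IsProbabilityMeasure ν]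
    (r : ℝ) : Integrable (fun p : ℝ × ℝ => max (r - |p.1 - p.2|) 0) (μ.prod ν) := by
  refine Integrable.of_bound (C := |r|) (by fun_prop) (Eventually.of_forall fun p => ?_)
  rw [Real.norm_of_nonneg (le_max_right _ _)]
  exact max_le (by linarith [abs_nonneg (p.1 - p.2), le_abs_self r]) (abs_nonneg r)

theorem integrable_window (μ ν : Measure ℝ) [IsProbabilityMeasure μ] [IsProbabilityMeasure ν]
    (r : ℝ) : Integrable (fun s => μ.real (Ioc s (s + r)) * ν.real (Ioc s (s + r))) ∧
      ∫ p, max (r - |p.1 - p.2|) 0 ∂(μ.prod ν) = windowCorrelation μ ν r := by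
  have h := lintegral_tent μ ν r
  have hf := (integrable_tent μ ν r).lintegral_lt_top
  rw [h] at hf
  have e : ∀ s, μ.real (Ioc s (s + r)) * ν.real (Ioc s (s + r)) =
      (μ (Ioc s (s + r)) * ν (Ioc s (s + r))).toReal := fun s => by
    rw [ENNReal.toReal_mul]; rfl
  have hm : Measurable fun s => μ (Ioc s (s + r)) * ν (Ioc s (s + r)) :=
    (measurable_measure_Ioc_add μ r).mul (measurable_measure_Ioc_add ν r)
  refine ⟨?_, ?_⟩
  · simp only [e]
    exact integrable_toReal_of_lintegral_ne_top hm.aemeasurable hf.ne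
  · rw [integral_eq_lintegral_of_nonneg_ae (f := fun p : ℝ × ℝ => max (r - |p.1 - p.2|) 0)
      (Eventually.of_forall fun p => le_max_right _ _)
      (integrable_tent μ ν r).aestronglyMeasurable, h]
    unfold windowCorrelation
    simp only [e]
    rw [integral_toReal hm.aemeasurable]
    exact Eventually.of_forall fun s => ENNReal.mul_lt_top (measure_lt_top _ _) (measure_lt_top _ _)

theorem integral_windowCorrelation (μ ν : Measure ℝ) [IsProbabilityMeasure μ]
    [IsProbabilityMeasure ν] (hd : ∀ᵐ p ∂(μ.prod ν), p.1 ≠ p.2)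
    (hi : Integrable (fun p : ℝ × ℝ => Real.log |p.1 - p.2|) (μ.prod ν)) :
    IntegrableOn (fun r => (windowCorrelation μ ν r - max (r - 1) 0) / r ^ 2) (Ioi 0) ∧
      ∫ r in Ioi (0 : ℝ), (windowCorrelation μ ν r - max (r - 1) 0) / r ^ 2 =
        -∫ p, Real.log |p.1 - p.2| ∂(μ.prod ν) := by
  have hm : Measurable fun q : (ℝ × ℝ) × ℝ => tentKernel (q.1.1 - q.1.2) q.2 :=
    measurable_tentKernel.comp
      (by fun_prop : Measurable fun q : (ℝ × ℝ) × ℝ => (q.1.1 - q.1.2, q.2))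
  have hI : Integrable (fun q : (ℝ × ℝ) × ℝ => tentKernel (q.1.1 - q.1.2) q.2)
      ((μ.prod ν).prod (volume.restrict (Ioi 0))) := by
    rw [integrable_prod_iff hm.aestronglyMeasurable]
    constructor
    · filter_upwards [hd] with p hp
      exact (integral_tentKernel (sub_ne_zero.2 hp)).1
    · refine hi.abs.congr ?_
      filter_upwards [hd] with p hp
      exact (integral_tentKernel (sub_ne_zero.2 hp)).2.2.symm
  have e : ∀ r, ∫ p, tentKernel (p.1 - p.2) r ∂(μ.prod ν) =
      (windowCorrelation μ ν r - max (r - 1) 0) / r ^ 2 := by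
    intro r
    unfold tentKernel
    rw [integral_div, integral_sub (integrable_tent μ ν r) (integrable_const _),
      (integrable_window μ ν r).2]
    simp
  refine ⟨?_, ?_⟩
  · have := hI.integral_prod_right
    simp only [e] at this
    exact this
  · have := integral_integral_swap (μ := μ.prod ν) (ν := volume.restrict (Ioi 0))
      (f := fun (p : ℝ × ℝ) (r : ℝ) => tentKernel (p.1 - p.2) r) hI
    simp only [e] at this
    rw [← this, ← integral_neg]
    refine integral_congr_ae ?_
    filter_upwards [hd] with p hp
    exact (integral_tentKernel (sub_ne_zero.2 hp)).2.1

theorem integral_sq_window_sub (μ ν : Measure ℝ) [IsProbabilityMeasure μ]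
    [IsProbabilityMeasure ν] (r : ℝ) :
    Integrable (fun s => (μ.real (Ioc s (s + r)) - ν.real (Ioc s (s + r))) ^ 2) ∧
      ∫ s, (μ.real (Ioc s (s + r)) - ν.real (Ioc s (s + r))) ^ 2 =
        windowCorrelation μ μ r + windowCorrelation ν ν r - 2 * windowCorrelation μ ν r := by
  have h1 := (integrable_window μ μ r).1
  have h2 := (integrable_window ν ν r).1
  have h3 := (integrable_window μ ν r).1
  have e : (fun s => (μ.real (Ioc s (s + r)) - ν.real (Ioc s (s + r))) ^ 2) = fun s =>
      (μ.real (Ioc s (s + r)) * μ.real (Ioc s (s + r)) +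
        ν.real (Ioc s (s + r)) * ν.real (Ioc s (s + r))) -
        2 * (μ.real (Ioc s (s + r)) * ν.real (Ioc s (s + r))) := by
    funext s; ring
  rw [e]
  have h12 : Integrable fun s => μ.real (Ioc s (s + r)) * μ.real (Ioc s (s + r)) +
    ν.real (Ioc s (s + r)) * ν.real (Ioc s (s + r)) := h1.add h2
  refine ⟨h12.sub (h3.const_mul 2), ?_⟩
  rw [integral_sub h12 (h3.const_mul 2), integral_add h1 h2, integral_const_mul]
  rfl

/-- If two probability measures give the same mass to almost every window `(s, s + r]` of one fixed
width `r`, then the difference of their distribution functions is right-continuous and `r`-periodic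
and vanishes at infinity, hence is zero. -/
theorem eq_of_ae_window_eq (μ ν : Measure ℝ) [IsProbabilityMeasure μ]
    [IsProbabilityMeasure ν] {r : ℝ} (hr : 0 < r)
    (h : ∀ᵐ s, μ.real (Ioc s (s + r)) = ν.real (Ioc s (s + r))) : μ = ν := by
  have hIoc : ∀ (ρ : Measure ℝ) [IsProbabilityMeasure ρ] (s : ℝ), ρ.real (Ioc s (s + r)) =
      ProbabilityTheory.cdf ρ (s + r) - ProbabilityTheory.cdf ρ s := by
    intro ρ _ s
    have := (ProbabilityTheory.cdf ρ).measure_Ioc s (s + r)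
    rw [ProbabilityTheory.measure_cdf] at this
    rw [measureReal_def, this, ENNReal.toReal_ofReal]
    exact sub_nonneg.2 ((ProbabilityTheory.cdf ρ).mono (by linarith))
  set G : ℝ → ℝ := fun s => ProbabilityTheory.cdf μ s - ProbabilityTheory.cdf ν s with hG
  have hrc : ∀ s, ContinuousWithinAt G (Ioi s) s := fun s =>
    (((ProbabilityTheory.cdf μ).right_continuous s).mono Ioi_subset_Ici_self).sub
      (((ProbabilityTheory.cdf ν).right_continuous s).mono Ioi_subset_Ici_self)
  have hae : ∀ᵐ s, G (s + r) = G s := by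
    filter_upwards [h] with s hs
    rw [hIoc, hIoc] at hs
    simp only [hG]; linarith
  have hdense : Dense {s | G (s + r) = G s} := Measure.dense_of_ae hae
  have hper : ∀ s, G (s + r) = G s := by
    intro s
    have hcl : (𝓝[Ioi s ∩ {s | G (s + r) = G s}] s).NeBot := by
      rw [← mem_closure_iff_nhdsWithin_neBot]
      have h1 := closure_mono (hdense.open_subset_closure_inter (isOpen_Ioi (a := s)))
      rw [closure_closure, closure_Ioi] at h1
      exact h1 self_mem_Ici
    have t1 : Tendsto G (𝓝[Ioi s ∩ {s | G (s + r) = G s}] s) (𝓝 (G s)) :=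
      (hrc s).mono_left (nhdsWithin_mono _ inter_subset_left)
    have t2 : Tendsto (fun x => G (x + r)) (𝓝[Ioi s ∩ {s | G (s + r) = G s}] s)
        (𝓝 (G (s + r))) := by
      have : Tendsto (fun x => x + r) (𝓝[Ioi s ∩ {s | G (s + r) = G s}] s)
          (𝓝[Ioi (s + r)] (s + r)) := by
        refine tendsto_nhdsWithin_iff.2 ⟨?_, ?_⟩
        · exact ((continuous_id.add continuous_const).tendsto s).mono_left nhdsWithin_le_nhds
        · filter_upwards [self_mem_nhdsWithin] with x hx
          exact add_lt_add_left hx.1 r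
      exact Tendsto.comp (hrc (s + r)) this
    refine tendsto_nhds_unique (t2.congr' ?_) t1
    filter_upwards [self_mem_nhdsWithin] with x hx
    exact hx.2
  have hlim : Tendsto G atTop (𝓝 0) := by
    simpa using (ProbabilityTheory.tendsto_cdf_atTop μ).sub (ProbabilityTheory.tendsto_cdf_atTop ν)
  have hzero : ∀ s, G s = 0 := by
    intro s
    have hn : ∀ n : ℕ, G (s + n * r) = G s := by
      intro n
      induction n with
      | zero => simp
      | succ k ih => rw [← ih, ← hper (s + k * r)]; congr 1; push_cast; ring
    have ht : Tendsto (fun n : ℕ => s + n * r) atTop atTop :=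
      tendsto_atTop_add_const_left _ _ (tendsto_natCast_atTop_atTop.atTop_mul_const hr)
    have := hlim.comp ht
    simp only [Function.comp_def, hn] at this
    exact tendsto_nhds_unique tendsto_const_nhds this
  refine Measure.eq_of_cdf μ ν ?_
  ext s
  exact sub_eq_zero.1 (hzero s)

/-- Strict conditional negative definiteness of the kernel `log |x - y|`. As `Real.log 0 = 0`,
integrability does not exclude mass on the diagonal, which is a hypothesis of its own. -/
theorem log_energy_le (μ ν : Measure ℝ) [IsProbabilityMeasure μ] [IsProbabilityMeasure ν]
    (hd1 : ∀ᵐ p ∂(μ.prod μ), p.1 ≠ p.2) (hd2 : ∀ᵐ p ∂(ν.prod ν), p.1 ≠ p.2)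
    (hd3 : ∀ᵐ p ∂(μ.prod ν), p.1 ≠ p.2)
    (hi1 : Integrable (fun p : ℝ × ℝ => Real.log |p.1 - p.2|) (μ.prod μ))
    (hi2 : Integrable (fun p : ℝ × ℝ => Real.log |p.1 - p.2|) (ν.prod ν))
    (hi3 : Integrable (fun p : ℝ × ℝ => Real.log |p.1 - p.2|) (μ.prod ν)) :
    (∫ p, Real.log |p.1 - p.2| ∂(μ.prod μ)) + (∫ p, Real.log |p.1 - p.2| ∂(ν.prod ν)) ≤
        2 * ∫ p, Real.log |p.1 - p.2| ∂(μ.prod ν) ∧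
      (2 * (∫ p, Real.log |p.1 - p.2| ∂(μ.prod ν)) ≤
        (∫ p, Real.log |p.1 - p.2| ∂(μ.prod μ)) + (∫ p, Real.log |p.1 - p.2| ∂(ν.prod ν)) →
        μ = ν) := by
  obtain ⟨a1, b1⟩ := integral_windowCorrelation μ μ hd1 hi1
  obtain ⟨a2, b2⟩ := integral_windowCorrelation ν ν hd2 hi2
  obtain ⟨a3, b3⟩ := integral_windowCorrelation μ ν hd3 hi3
  set D : ℝ → ℝ := fun r => (∫ s, (μ.real (Ioc s (s + r)) - ν.real (Ioc s (s + r))) ^ 2) / r ^ 2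
    with hD
  have e : D = fun r => ((windowCorrelation μ μ r - max (r - 1) 0) / r ^ 2 +
      (windowCorrelation ν ν r - max (r - 1) 0) / r ^ 2) -
      2 * ((windowCorrelation μ ν r - max (r - 1) 0) / r ^ 2) := by
    funext r
    simp only [hD]
    rw [(integral_sq_window_sub μ ν r).2]
    ring
  have hDi : IntegrableOn D (Ioi 0) := by
    rw [e]; exact (a1.add a2).sub (a3.const_mul 2)
  have hDint : ∫ r in Ioi 0, D r = -(∫ p, Real.log |p.1 - p.2| ∂(μ.prod μ)) -
      (∫ p, Real.log |p.1 - p.2| ∂(ν.prod ν)) + 2 * ∫ p, Real.log |p.1 - p.2| ∂(μ.prod ν) := by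
    have a12 : IntegrableOn (fun r => (windowCorrelation μ μ r - max (r - 1) 0) / r ^ 2 +
      (windowCorrelation ν ν r - max (r - 1) 0) / r ^ 2) (Ioi 0) := a1.add a2
    simp only [e]
    rw [integral_sub a12 (a3.const_mul 2), integral_add a1 a2, integral_const_mul,
      b1, b2, b3]
    ring
  have hDn : ∀ r, 0 ≤ D r := fun r =>
    div_nonneg (integral_nonneg fun s => sq_nonneg _) (sq_nonneg r)
  have hDn' : 0 ≤ ∫ r in Ioi 0, D r := integral_nonneg hDn
  refine ⟨by linarith, fun hle => ?_⟩
  have h0 : ∫ r in Ioi 0, D r = 0 := le_antisymm (by linarith) hDn'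
  have hae := (integral_eq_zero_iff_of_nonneg hDn hDi).1 h0
  have hne : (ae (volume.restrict (Ioi (0 : ℝ)))).NeBot := by
    rw [ae_neBot, Ne, Measure.restrict_eq_zero]; simp
  obtain ⟨r, hr, hr0⟩ := (hae.and (ae_restrict_mem measurableSet_Ioi)).exists
  have hr0 : 0 < r := hr0
  have hz : ∫ s, (μ.real (Ioc s (s + r)) - ν.real (Ioc s (s + r))) ^ 2 = 0 := by
    have : r ^ 2 ≠ 0 := by positivity
    simpa [hD, this] using hr
  have := (integral_eq_zero_iff_of_nonneg (fun s => sq_nonneg _)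
    (integral_sq_window_sub μ ν r).1).1 hz
  refine eq_of_ae_window_eq μ ν hr0 ?_
  filter_upwards [this] with s hs
  simpa [sub_eq_zero] using hs

/-! ### Extended-real logarithmic integrals -/

theorem extLogAbs_zero : extLogAbs 0 = ⊥ := by simp [extLogAbs]

theorem extLogAbs_of_ne_zero {t : ℝ} (ht : t ≠ 0) : extLogAbs t = (Real.log |t| : EReal) := by
  unfold extLogAbs
  rw [Real.enorm_eq_ofReal_abs, ENNReal.log_ofReal_of_pos (abs_pos.2 ht)]

theorem extIntegral_eq_integral {α : Type*} [MeasurableSpace α] {μ : Measure α} {f : α → EReal}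
    {g : α → ℝ} (hg : Integrable g μ) (hfg : ∀ᵐ x ∂μ, f x = (g x : EReal)) :
    extIntegral μ f = ((∫ x, g x ∂μ : ℝ) : EReal) := by
  unfold extIntegral
  have h1 : ∫⁻ x, (f x).toENNReal ∂μ = ∫⁻ x, ENNReal.ofReal (g x) ∂μ :=
    lintegral_congr_ae (by
      filter_upwards [hfg] with x hx
      rw [hx, EReal.real_coe_toENNReal])
  have h2 : ∫⁻ x, (-f x).toENNReal ∂μ = ∫⁻ x, ENNReal.ofReal (-g x) ∂μ :=
    lintegral_congr_ae (by
      filter_upwards [hfg] with x hx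
      rw [hx, ← EReal.coe_neg, EReal.real_coe_toENNReal])
  have f1 := hg.lintegral_lt_top.ne
  have f2 := hg.neg.lintegral_lt_top.ne
  simp only [Pi.neg_apply] at f2
  rw [h1, h2, integral_eq_lintegral_pos_part_sub_lintegral_neg_part hg, EReal.coe_sub,
    EReal.coe_ennreal_toReal f1, EReal.coe_ennreal_toReal f2]

theorem extIntegral_extLogAbs {α : Type*} [MeasurableSpace α] {μ : Measure α} {h : α → ℝ}
    (h0 : ∀ᵐ x ∂μ, h x ≠ 0) (hi : Integrable (fun x => Real.log |h x|) μ) :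
    extIntegral μ (fun x => extLogAbs (h x)) = ((∫ x, Real.log |h x| ∂μ : ℝ) : EReal) :=
  extIntegral_eq_integral hi (h0.mono fun _ hx => extLogAbs_of_ne_zero hx)

/-- A nonnegative extended logarithmic integral whose positive part is finite is a genuine integral:
the argument of the logarithm vanishes only on a null set and the logarithm is integrable. -/
theorem integrable_log_of_extIntegral_nonneg {α : Type*} [MeasurableSpace α] {μ : Measure α}
    {h : α → ℝ} (hm : Measurable h) (hpos : ∫⁻ x, ENNReal.ofReal (Real.log |h x|) ∂μ ≠ ⊤)
    (hn : 0 ≤ extIntegral μ (fun x => extLogAbs (h x))) :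
    (∀ᵐ x ∂μ, h x ≠ 0) ∧ Integrable (fun x => Real.log |h x|) μ := by
  have hme : Measurable extLogAbs := by unfold extLogAbs; fun_prop
  unfold extIntegral at hn
  have h1 : ∫⁻ x, (extLogAbs (h x)).toENNReal ∂μ ≠ ⊤ := by
    refine ne_top_of_le_ne_top hpos (lintegral_mono fun x => ?_)
    by_cases hx : h x = 0
    · simp [hx, extLogAbs_zero]
    · rw [extLogAbs_of_ne_zero hx]; simp
  have h2 : ∫⁻ x, (-extLogAbs (h x)).toENNReal ∂μ ≠ ⊤ := by
    intro htop
    rw [htop] at hn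
    simp at hn
  have h3 : ∀ᵐ x ∂μ, h x ≠ 0 := by
    have := ae_lt_top' (by fun_prop) h2
    filter_upwards [this] with x hx h0
    simp [h0, extLogAbs_zero] at hx
  refine ⟨h3, (Real.measurable_log.comp hm.abs).aestronglyMeasurable, ?_⟩
  rw [hasFiniteIntegral_iff_norm]
  have h4 : ∫⁻ x, ENNReal.ofReal ‖Real.log |h x|‖ ∂μ ≤
      ∫⁻ x, ENNReal.ofReal (Real.log |h x|) ∂μ + ∫⁻ x, (-extLogAbs (h x)).toENNReal ∂μ := by
    rw [← lintegral_add_left (by fun_prop)]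
    refine lintegral_mono_ae ?_
    filter_upwards [h3] with x hx
    rw [extLogAbs_of_ne_zero hx, ← EReal.coe_neg, EReal.real_coe_toENNReal, Real.norm_eq_abs]
    rcases abs_cases (Real.log |h x|) with ⟨h, _⟩ | ⟨h, _⟩ <;> rw [h]
    · exact le_self_add
    · exact le_add_self
  exact h4.trans_lt (ENNReal.add_lt_top.2 ⟨hpos.lt_top, h2.lt_top⟩)

theorem integrable_id_of_meanValue_ne_top {μ : Measure ℝ} (h0 : μ (Iio 0) = 0)
    (hm : meanValue μ ≠ ⊤) : Integrable (fun x : ℝ => x) μ ∧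
      meanValue μ = ENNReal.ofReal (∫ x, x ∂μ) ∧ 0 ≤ ∫ x, x ∂μ := by
  have hae : ∀ᵐ x ∂μ, 0 ≤ x := by
    rw [ae_iff]
    convert h0 using 2
    ext x; simp
  have hi : Integrable (fun x : ℝ => x) μ := by
    refine ⟨by fun_prop, ?_⟩
    rw [hasFiniteIntegral_iff_norm]
    refine lt_of_le_of_lt (lintegral_mono_ae ?_) hm.lt_top
    filter_upwards [hae] with x hx
    rw [Real.norm_of_nonneg hx]
  exact ⟨hi, (ofReal_integral_eq_lintegral_ofReal hi hae).symm, integral_nonneg_of_ae hae⟩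

theorem lintegral_posLog_sub_ne_top {μ ν : Measure ℝ} [IsProbabilityMeasure μ]
    [IsProbabilityMeasure ν] (hμ : Integrable (fun x : ℝ => x) μ)
    (hν : Integrable (fun x : ℝ => x) ν) :
    ∫⁻ p, ENNReal.ofReal (Real.log |p.1 - p.2|) ∂(μ.prod ν) ≠ ⊤ := by
  have h : Integrable (fun p : ℝ × ℝ => |p.1 - p.2|) (μ.prod ν) :=
    ((hμ.comp_fst ν).sub (hν.comp_snd μ)).abs
  refine ne_top_of_le_ne_top h.lintegral_lt_top.ne (lintegral_mono fun p => ?_)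
  exact ENNReal.ofReal_le_ofReal (Real.log_le_self (abs_nonneg _))

theorem lintegral_ofReal_neg_log_ne_top : ∫⁻ u : ℝ, ENNReal.ofReal (-Real.log |u|) ≠ ⊤ := by
  have hi : IntegrableOn (fun u : ℝ => -Real.log |u|) (Ioc (-1) 1) := by
    have := (intervalIntegral.intervalIntegrable_log' (a := -1) (b := 1))
    rw [intervalIntegrable_iff_integrableOn_Ioc_of_le (by norm_num)] at this
    simp only [Real.log_abs]
    exact this.neg
  refine ne_top_of_le_ne_top hi.lintegral_lt_top.ne ?_
  rw [← lintegral_indicator measurableSet_Ioc]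
  refine lintegral_mono fun u => ?_
  by_cases hu : u ∈ Ioc (-1 : ℝ) 1
  · simp [hu]
  · have : 1 ≤ |u| := by
      by_contra! hlt
      exact hu ⟨(abs_lt.1 hlt).1, (abs_lt.1 hlt).2.le⟩
    rw [ENNReal.ofReal_of_nonpos (by linarith [Real.log_nonneg this])]
    exact zero_le

/-- The logarithmic kernel is integrable against `μ × ν` as soon as both measures have a mean and
`ν` has a bounded density. -/
theorem integrable_log_sub_prod {μ ν : Measure ℝ} [IsProbabilityMeasure μ]
    [IsProbabilityMeasure ν] (hμ : Integrable (fun x : ℝ => x) μ)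
    (hν : Integrable (fun x : ℝ => x) ν) {C : ℝ≥0∞} (hC : C ≠ ⊤) (h : ν ≤ C • volume) :
    (∀ᵐ p ∂(μ.prod ν), p.1 ≠ p.2) ∧
      Integrable (fun p : ℝ × ℝ => Real.log |p.1 - p.2|) (μ.prod ν) := by
  have hm : Measurable fun p : ℝ × ℝ => Real.log |p.1 - p.2| :=
    Real.measurable_log.comp (by fun_prop)
  refine ⟨?_, hm.aestronglyMeasurable, ?_⟩
  · refine (Measure.ae_prod_iff_ae_ae ?_).2 (Eventually.of_forall fun x => ?_)
    · exact (measurableSet_eq_fun measurable_fst measurable_snd).compl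
    · rw [ae_iff]
      refine le_antisymm ((h _).trans ?_) zero_le
      simp
  · rw [hasFiniteIntegral_iff_norm]
    have hneg : ∫⁻ p, ENNReal.ofReal (-Real.log |p.1 - p.2|) ∂(μ.prod ν) ≠ ⊤ := by
      have hx : ∀ x : ℝ, ∫⁻ y, ENNReal.ofReal (-Real.log |x - y|) ∂ν ≤
          C * ∫⁻ u : ℝ, ENNReal.ofReal (-Real.log |u|) := fun x => by
        refine (lintegral_mono' h le_rfl).trans ?_
        rw [lintegral_smul_measure, smul_eq_mul]
        rw [lintegral_sub_left_eq_self (fun u => ENNReal.ofReal (-Real.log |u|)) x]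
      have hm' : Measurable fun p : ℝ × ℝ => -Real.log |p.1 - p.2| := hm.neg
      rw [lintegral_prod _ hm'.ennreal_ofReal.aemeasurable]
      refine ne_top_of_le_ne_top ?_ (lintegral_mono hx)
      simpa using ENNReal.mul_ne_top hC lintegral_ofReal_neg_log_ne_top
    have hpos := lintegral_posLog_sub_ne_top hμ hν
    have h4 : ∫⁻ p, ENNReal.ofReal ‖Real.log |p.1 - p.2|‖ ∂(μ.prod ν) ≤
        ∫⁻ p, ENNReal.ofReal (Real.log |p.1 - p.2|) ∂(μ.prod ν) +
          ∫⁻ p, ENNReal.ofReal (-Real.log |p.1 - p.2|) ∂(μ.prod ν) := by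
      rw [← lintegral_add_left hm.ennreal_ofReal]
      refine lintegral_mono fun p => ?_
      rw [Real.norm_eq_abs]
      rcases abs_cases (Real.log |p.1 - p.2|) with ⟨h, _⟩ | ⟨h, _⟩ <;> rw [h]
      · exact le_self_add
      · exact le_add_self
    exact h4.trans_lt (ENNReal.add_lt_top.2 ⟨hpos.lt_top, hneg.lt_top⟩)

/-- The potential of a measure with a mean and a bounded density is finite everywhere. -/
theorem integrable_log_sub_left {ν : Measure ℝ} [IsProbabilityMeasure ν]
    (hν : Integrable (fun x : ℝ => x) ν) {C : ℝ≥0∞} (hC : C ≠ ⊤) (h : ν ≤ C • volume) (x : ℝ) :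
    (∀ᵐ y ∂ν, x - y ≠ 0) ∧ Integrable (fun y => Real.log |x - y|) ν := by
  -- the product statement with `μ` a point mass at `x`
  have hx : Integrable (fun x : ℝ => x) (Measure.dirac x) := integrable_dirac (by simp)
  obtain ⟨h1, h2⟩ := integrable_log_sub_prod hx hν hC h
  rw [Measure.dirac_prod] at h1 h2
  have he : MeasurableEmbedding (Prod.mk x : ℝ → ℝ × ℝ) := measurableEmbedding_prodMk_left x
  rw [he.integrable_map_iff] at h2
  rw [he.ae_map_iff] at h1
  exact ⟨h1.mono fun y hy => sub_ne_zero.2 hy, h2⟩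

/-! ### Circle averages of the logarithm against the weight -/

/-- The weight `sin² θ / |1 + r e^{iθ}|²`. In the parametrization `t = T |1 + r e^{iθ}|²` of the
support, Siegel's measure is `2 / π` times this weight on `(0, π)`. -/
def siegelWeight (r θ : ℝ) : ℝ := Real.sin θ ^ 2 / (1 + r ^ 2 + 2 * r * Real.cos θ)

theorem siegelWeight_denom_pos {r : ℝ} (h0 : 0 < r) (h1 : r < 1) (θ : ℝ) :
    0 < 1 + r ^ 2 + 2 * r * Real.cos θ := by
  nlinarith [Real.neg_one_le_cos θ, sq_nonneg (1 - r), mul_pos h0 (sub_pos.2 h1)]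

theorem continuous_siegelWeight {r : ℝ} (h0 : 0 < r) (h1 : r < 1) :
    Continuous (siegelWeight r) := by
  unfold siegelWeight
  exact Continuous.div (by fun_prop) (by fun_prop) fun θ => (siegelWeight_denom_pos h0 h1 θ).ne'

theorem siegelWeight_nonneg {r : ℝ} (h0 : 0 < r) (h1 : r < 1) (θ : ℝ) : 0 ≤ siegelWeight r θ :=
  div_nonneg (sq_nonneg _) (siegelWeight_denom_pos h0 h1 θ).le

theorem norm_circleMap_add_sq (r θ : ℝ) :
    ‖circleMap 0 1 θ + r‖ ^ 2 = 1 + r ^ 2 + 2 * r * Real.cos θ := by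
  rw [← Complex.normSq_eq_norm_sq, Complex.normSq_apply]
  simp [circleMap, Complex.exp_ofReal_mul_I_re, Complex.exp_ofReal_mul_I_im]
  nlinarith [Real.sin_sq_add_cos_sq θ]

/-- Partial fractions: the weight is a combination of `1`, `cos θ` and the Poisson kernel of the
unit disc at the point `-r`. -/
theorem siegelWeight_eq {r : ℝ} (h0 : 0 < r) (h1 : r < 1) (θ : ℝ) :
    siegelWeight r θ = (1 + r ^ 2) / (4 * r ^ 2) - 1 / (2 * r) * (circleMap 0 1 θ).re -
      (1 - r ^ 2) / (4 * r ^ 2) * poissonKernel 0 (-r) (circleMap 0 1 θ) := by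
  rw [poissonKernel_def]
  simp only [sub_zero, sub_neg_eq_add, norm_circleMap_add_sq]
  have hD := (siegelWeight_denom_pos h0 h1 θ).ne'
  have : (circleMap 0 1 θ).re = Real.cos θ := by
    simp [circleMap, Complex.exp_ofReal_mul_I_re]
  rw [this]
  simp only [norm_circleMap_zero, norm_neg, Complex.norm_real, Real.norm_eq_abs, sq_abs,
    siegelWeight]
  rw [Real.sin_sq]
  generalize Real.cos θ = c at hD
  have h4 : (4 : ℝ) * r ^ 2 ≠ 0 := by positivity
  have h2 : (2 : ℝ) * r ≠ 0 := by positivity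
  generalize hE : 1 + r ^ 2 + 2 * r * c = D at hD
  have hc : c = (D - 1 - r ^ 2) / (2 * r) := by field_simp; linarith
  rw [hc]
  field_simp
  ring

/-- On the unit circle `Re z = (z + z⁻¹) / 2`; the first term averages to zero, the second to the
derivative at the centre. -/
theorem circleAverage_re_mul {f : ℂ → ℂ} {U : Set ℂ} (hU : IsOpen U)
    (hc : Metric.closedBall 0 1 ⊆ U) (hf : DifferentiableOn ℂ f U) :
    Real.circleAverage (fun z => (z.re : ℂ) * f z) 0 1 = deriv f 0 / 2 := by
  have hs : Metric.sphere (0 : ℂ) 1 ⊆ U := Metric.sphere_subset_closedBall.trans hc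
  have hcs : ContinuousOn f (Metric.sphere (0 : ℂ) 1) := hf.continuousOn.mono hs
  have h1 : Real.circleAverage (fun z => z * f z) 0 1 = 0 := by
    have hd : DiffContOnCl ℂ (fun z => z * f z) (Metric.ball 0 |1|) := by
      rw [abs_one]
      refine DifferentiableOn.diffContOnCl ?_
      rw [closure_ball _ one_ne_zero]
      exact differentiableOn_id.mul (hf.mono hc)
    rw [hd.circleAverage]; simp
  have h2 : Real.circleAverage (fun z => z⁻¹ * f z) 0 1 = deriv f 0 := by
    rw [Real.circleAverage_eq_circleIntegral one_ne_zero,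
      ← Complex.two_pi_I_inv_smul_circleIntegral_sub_sq_inv_smul_of_differentiable hU hc hf
        (Metric.mem_ball_self one_pos)]
    simp [pow_two, mul_assoc]
  have hi1 : CircleIntegrable (fun z => z * f z) 0 1 :=
    ContinuousOn.circleIntegrable zero_le_one (continuousOn_id.mul hcs)
  have hi2 : CircleIntegrable (fun z => z⁻¹ * f z) 0 1 :=
    ContinuousOn.circleIntegrable zero_le_one ((continuousOn_id.inv₀ fun z hz => by
      rintro rfl; simp at hz).mul hcs)
  have h3 : Real.circleAverage (fun z => (z.re : ℂ) * f z) 0 1 =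
      Real.circleAverage (fun z => (2⁻¹ : ℝ) • (z * f z + z⁻¹ * f z)) 0 1 := by
    refine Real.circleAverage_congr_sphere fun z hz => ?_
    have hz1 : ‖z‖ = 1 := by simpa using hz
    have : z⁻¹ = (starRingEnd ℂ) z := by
      rw [Complex.inv_def, Complex.normSq_eq_norm_sq, hz1]; simp
    simp only [this, Complex.real_smul, ← add_mul, Complex.add_conj]
    push_cast
    ring
  rw [h3, Real.circleAverage_fun_smul, Real.circleAverage_fun_add hi1 hi2, h1, h2]
  simp
  ring

theorem one_sub_mul_mem_slitPlane {w z : ℂ} (h : ‖w * z‖ < 1) : 1 - w * z ∈ Complex.slitPlane := by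
  refine Complex.mem_slitPlane_iff.2 (Or.inl ?_)
  have := (Complex.re_le_norm (w * z)).trans_lt h
  simp only [Complex.sub_re, Complex.one_re]
  linarith

theorem circleIntegrable_log_norm_one_sub (w : ℂ) :
    CircleIntegrable (fun z => Real.log ‖1 - w * z‖) 0 1 :=
  MeromorphicOn.circleIntegrable_log_norm (f := fun z => 1 - w * z) (by intro z _; fun_prop)

theorem integral_re_circleMap {f : ℂ → ℂ} (hf : CircleIntegrable f 0 1) :
    IntervalIntegrable (fun θ => (f (circleMap 0 1 θ)).re) volume 0 (2 * Real.pi) ∧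
      ∫ θ in 0..2 * Real.pi, (f (circleMap 0 1 θ)).re =
        2 * Real.pi * (Real.circleAverage f 0 1).re := by
  have h := Complex.reCLM.circleAverage_comp_comm hf
  rw [Real.circleAverage_def, smul_eq_mul, inv_mul_eq_iff_eq_mul₀ (by positivity)] at h
  exact ⟨(intervalIntegrable_iff.2 (intervalIntegrable_iff.1 hf).re), h⟩

theorem continuousOn_poissonKernel_sphere {r : ℝ} (h0 : 0 < r) (h1 : r < 1) :
    ContinuousOn (poissonKernel 0 (-r : ℂ)) (Metric.sphere (0 : ℂ) 1) := by
  rw [show poissonKernel 0 (-r : ℂ) = fun z => (‖z - 0‖ ^ 2 - ‖(-r : ℂ) - 0‖ ^ 2) /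
    ‖(z - 0) - ((-r : ℂ) - 0)‖ ^ 2 from funext fun z => poissonKernel_def _ _ _]
  refine ContinuousOn.div (by fun_prop) (by fun_prop) fun z hz => ?_
  have hz1 : ‖z‖ = 1 := by simpa using hz
  have : z - 0 - (-r - 0) ≠ 0 := fun h => by
    have : z = -(r : ℂ) := by linear_combination h
    rw [this] at hz1
    simp [abs_of_pos h0] at hz1
    linarith
  positivity

/-- The integral of `siegelWeight` against the real part of a function holomorphic near the closed
disc, by Cauchy's and Poisson's formulas. -/
theorem integral_siegelWeight_mul_re {r : ℝ} (h0 : 0 < r) (h1 : r < 1) {f : ℂ → ℂ} {U : Set ℂ}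
    (hU : IsOpen U) (hcU : Metric.closedBall 0 1 ⊆ U) (hf : DifferentiableOn ℂ f U) :
    ∫ θ in 0..2 * Real.pi, siegelWeight r θ * (f (circleMap 0 1 θ)).re =
      2 * Real.pi * ((1 + r ^ 2) / (4 * r ^ 2) * (f 0).re - (deriv f 0).re / (4 * r) -
        (1 - r ^ 2) / (4 * r ^ 2) * (f (-r)).re) := by
  have hd : DiffContOnCl ℂ f (Metric.ball 0 1) := by
    refine DifferentiableOn.diffContOnCl ?_
    rw [closure_ball _ one_ne_zero]
    exact hf.mono hcU
  have hcs : ContinuousOn f (Metric.sphere (0 : ℂ) 1) :=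
    hf.continuousOn.mono (Metric.sphere_subset_closedBall.trans hcU)
  have hmem : (-r : ℂ) ∈ Metric.ball (0 : ℂ) 1 := by simp [abs_of_pos h0, h1]
  have e1 : Real.circleAverage f 0 1 = f 0 :=
    DiffContOnCl.circleAverage (R := 1) (by rwa [abs_one])
  have e2 := circleAverage_re_mul hU hcU hf
  have e3 := hd.circleAverage_poissonKernel_smul hmem
  obtain ⟨j1, k1⟩ := integral_re_circleMap (hcs.circleIntegrable zero_le_one)
  obtain ⟨j2, k2⟩ := integral_re_circleMap (f := fun z => (z.re : ℂ) * f z)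
    (ContinuousOn.circleIntegrable zero_le_one
      ((by fun_prop : Continuous fun z : ℂ => (z.re : ℂ)).continuousOn.mul hcs))
  obtain ⟨j3, k3⟩ := integral_re_circleMap (f := poissonKernel 0 (-r : ℂ) • f)
    (ContinuousOn.circleIntegrable zero_le_one
      ((continuousOn_poissonKernel_sphere h0 h1).smul hcs))
  rw [e1] at k1
  rw [e2] at k2
  rw [e3] at k3
  have hint : ∀ θ : ℝ, siegelWeight r θ * (f (circleMap 0 1 θ)).re =
      (1 + r ^ 2) / (4 * r ^ 2) * (f (circleMap 0 1 θ)).re -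
        1 / (2 * r) * (((circleMap 0 1 θ).re : ℂ) * f (circleMap 0 1 θ)).re -
        (1 - r ^ 2) / (4 * r ^ 2) * ((poissonKernel 0 (-r : ℂ) • f) (circleMap 0 1 θ)).re := by
    intro θ
    rw [siegelWeight_eq h0 h1]
    simp only [Pi.smul_apply', Complex.real_smul, Complex.re_ofReal_mul]
    ring
  simp only [hint]
  rw [intervalIntegral.integral_sub ((j1.const_mul _).sub (j2.const_mul _)) (j3.const_mul _),
    intervalIntegral.integral_sub (j1.const_mul _) (j2.const_mul _),
    intervalIntegral.integral_const_mul, intervalIntegral.integral_const_mul,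
    intervalIntegral.integral_const_mul, k1, k2, k3]
  have hw2 : (deriv f 0 / 2).re = (deriv f 0).re / 2 := by simp
  rw [hw2]
  field_simp
  ring

theorem integral_siegelWeight {r : ℝ} (h0 : 0 < r) (h1 : r < 1) :
    ∫ θ in 0..2 * Real.pi, siegelWeight r θ = Real.pi := by
  have h := integral_siegelWeight_mul_re h0 h1 (f := fun _ => 1) isOpen_univ (subset_univ _)
    (differentiableOn_const 1)
  simp only [Complex.one_re, mul_one, deriv_const, Complex.zero_re] at h
  rw [h]
  field_simp
  ring

theorem integral_siegelWeight_mul_log_of_lt {r : ℝ} (h0 : 0 < r) (h1 : r < 1) {w : ℂ}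
    (hw : ‖w‖ < 1) :
    ∫ θ in 0..2 * Real.pi, siegelWeight r θ * Real.log ‖1 - w * circleMap 0 1 θ‖ =
      2 * Real.pi * (w.re / (4 * r) - (1 - r ^ 2) / (4 * r ^ 2) * Real.log ‖1 + w * r‖) := by
  have hU : IsOpen {z : ℂ | ‖w * z‖ < 1} := isOpen_lt (by fun_prop) continuous_const
  have hcU : Metric.closedBall 0 1 ⊆ {z : ℂ | ‖w * z‖ < 1} := fun z hz => by
    have hz1 : ‖z‖ ≤ 1 := by simpa using hz
    change ‖w * z‖ < 1
    rw [norm_mul]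
    nlinarith [norm_nonneg w, norm_nonneg z]
  have hf : DifferentiableOn ℂ (fun z => Complex.log (1 - w * z)) {z : ℂ | ‖w * z‖ < 1} :=
    fun z hz => (DifferentiableAt.clog (f := fun z => 1 - w * z) (by fun_prop)
      (one_sub_mul_mem_slitPlane hz)).differentiableWithinAt
  have hder : deriv (fun z => Complex.log (1 - w * z)) 0 = -w := by
    have : HasDerivAt (fun z => Complex.log (1 - w * z)) ((-w) / (1 - w * 0)) 0 := by
      refine HasDerivAt.clog ?_ (by simp)
      simpa using ((hasDerivAt_id (0 : ℂ)).const_mul w).const_sub 1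
    simpa using this.deriv
  have h := integral_siegelWeight_mul_re h0 h1 hU hcU hf
  rw [hder] at h
  simp only [Complex.log_re] at h
  rw [h]
  simp
  ring

/-- Extension of `integral_siegelWeight_mul_log_of_lt` to the closed disc: replace `w` by `s w`
and let `s → 1` under dominated convergence. The bound is `|1 - w z| ≤ 2 |1 - s w z|`. -/
theorem integral_siegelWeight_mul_log {r : ℝ} (h0 : 0 < r) (h1 : r < 1) {w : ℂ}
    (hw : ‖w‖ ≤ 1) :
    ∫ θ in 0..2 * Real.pi, siegelWeight r θ * Real.log ‖1 - w * circleMap 0 1 θ‖ =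
      2 * Real.pi * (w.re / (4 * r) - (1 - r ^ 2) / (4 * r ^ 2) * Real.log ‖1 + w * r‖) := by
  rcases eq_or_ne w 0 with rfl | hw0
  · simp
  have hne : 1 + w * r ≠ 0 := fun h => by
    have : ‖w * r‖ = 1 := by
      rw [show w * r = -1 by linear_combination h]; simp
    rw [norm_mul, Complex.norm_real, Real.norm_of_nonneg h0.le] at this
    nlinarith
  have hs : ∀ᶠ s : ℝ in 𝓝[<] 1, 0 < s ∧ s < 1 := by
    have := Ioo_mem_nhdsLT (show (0 : ℝ) < 1 by norm_num)
    filter_upwards [this] with s hs using hs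
  have hlim : Tendsto (fun s : ℝ => ∫ θ in 0..2 * Real.pi,
      siegelWeight r θ * Real.log ‖1 - (s * w) * circleMap 0 1 θ‖) (𝓝[<] 1)
      (𝓝 (∫ θ in 0..2 * Real.pi, siegelWeight r θ * Real.log ‖1 - w * circleMap 0 1 θ‖)) := by
    have hae : ∀ᵐ θ : ℝ, 1 - w * circleMap 0 1 θ ≠ 0 := by
      have hc := ((countable_singleton w⁻¹).preimage_circleMap 0 one_ne_zero).measure_zero volume
      filter_upwards [measure_eq_zero_iff_ae_notMem.1 hc] with θ hθ h
      refine hθ ?_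
      simp only [mem_preimage, mem_singleton_iff]
      exact eq_inv_of_mul_eq_one_right (by linear_combination -h)
    refine intervalIntegral.tendsto_integral_filter_of_dominated_convergence
      (fun θ => siegelWeight r θ * (Real.log 2 + |Real.log ‖1 - w * circleMap 0 1 θ‖|)) ?_ ?_ ?_ ?_
    · refine Eventually.of_forall fun s => Measurable.aestronglyMeasurable ?_
      have hc := (continuous_circleMap 0 1).measurable
      exact (continuous_siegelWeight h0 h1).measurable.mul (Real.measurable_log.comp (by fun_prop))
    · filter_upwards [hs] with s hs
      filter_upwards [hae] with θ hθ _
      rw [norm_mul, Real.norm_of_nonneg (siegelWeight_nonneg h0 h1 θ)]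
      refine mul_le_mul_of_nonneg_left ?_ (siegelWeight_nonneg h0 h1 θ)
      set v := w * circleMap 0 1 θ with hv
      have hv1 : ‖v‖ ≤ 1 := by rw [hv, norm_mul]; simpa using hw
      rw [mul_assoc, ← hv]
      have hpos : 0 < ‖1 - v‖ := norm_pos_iff.2 hθ
      have hup : ‖1 - s * v‖ ≤ 2 := by
        refine (norm_sub_le _ _).trans ?_
        rw [norm_mul, Complex.norm_real, Real.norm_of_nonneg hs.1.le, norm_one]
        nlinarith [norm_nonneg v]
      -- `|1 - v| ≤ |1 - s v| + (1 - s) |v|` and `1 - s ≤ |1 - s v|`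
      have hlow : ‖1 - v‖ ≤ 2 * ‖1 - s * v‖ := by
        have a1 : ‖1 - v‖ ≤ ‖1 - s * v‖ + ‖((1 - s : ℝ) : ℂ) * v‖ := by
          refine le_trans (le_of_eq ?_) (norm_sub_le _ _)
          congr 1
          push_cast; ring
        have a2 : 1 ≤ ‖1 - s * v‖ + ‖s * v‖ := by
          refine le_trans (le_of_eq ?_) (norm_add_le _ _)
          simp
        rw [norm_mul, Complex.norm_real, Real.norm_of_nonneg (by linarith [hs.2])] at a1
        rw [norm_mul, Complex.norm_real, Real.norm_of_nonneg hs.1.le] at a2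
        nlinarith [norm_nonneg v, hs.1, hs.2]
      have hpos' : 0 < ‖1 - s * v‖ := by linarith
      have b1 : Real.log ‖1 - s * v‖ ≤ Real.log 2 := Real.log_le_log hpos' hup
      have b2 : Real.log ‖1 - v‖ ≤ Real.log 2 + Real.log ‖1 - s * v‖ := by
        rw [← Real.log_mul (by norm_num) hpos'.ne']
        exact Real.log_le_log hpos hlow
      rw [Real.norm_eq_abs, abs_le]
      constructor
      · linarith [neg_abs_le (Real.log ‖1 - v‖)]
      · linarith [abs_nonneg (Real.log ‖1 - v‖)]
    · have hci : IntervalIntegrable (fun θ => Real.log ‖1 - w * circleMap 0 1 θ‖) volume 0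
          (2 * Real.pi) := circleIntegrable_log_norm_one_sub w
      exact (intervalIntegrable_const.add hci.abs).continuousOn_mul
        (continuous_siegelWeight h0 h1).continuousOn
    · filter_upwards [hae] with θ hθ _
      refine Tendsto.const_mul _ ?_
      have : Tendsto (fun s : ℝ => ‖1 - s * w * circleMap 0 1 θ‖) (𝓝[<] 1)
          (𝓝 ‖1 - w * circleMap 0 1 θ‖) := by
        have hc : Continuous fun s : ℝ => ‖1 - s * w * circleMap 0 1 θ‖ := by fun_prop
        have := (hc.tendsto 1).mono_left (nhdsWithin_le_nhds (s := Iio 1))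
        simpa using this
      exact this.log (norm_ne_zero_iff.2 hθ)
  have hlim2 : Tendsto (fun s : ℝ => 2 * Real.pi * (((s : ℂ) * w).re / (4 * r) -
      (1 - r ^ 2) / (4 * r ^ 2) * Real.log ‖1 + s * w * r‖)) (𝓝[<] 1)
      (𝓝 (2 * Real.pi * (w.re / (4 * r) - (1 - r ^ 2) / (4 * r ^ 2) * Real.log ‖1 + w * r‖))) := by
    have hc : ContinuousAt (fun s : ℝ => 2 * Real.pi * (((s : ℂ) * w).re / (4 * r) -
      (1 - r ^ 2) / (4 * r ^ 2) * Real.log ‖1 + s * w * r‖)) 1 := by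
      have hl : ContinuousAt (fun s : ℝ => Real.log ‖1 + s * w * r‖) 1 := by
        refine ContinuousAt.log (by fun_prop) ?_
        simpa using hne
      have h2 : ContinuousAt (fun s : ℝ => ((s : ℂ) * w).re / (4 * r)) 1 := by
        have : Continuous fun s : ℝ => ((s : ℂ) * w).re := by fun_prop
        exact (this.div_const _).continuousAt
      exact continuousAt_const.mul (h2.sub (continuousAt_const.mul hl))
    have := hc.tendsto.mono_left (nhdsWithin_le_nhds (s := Iio 1))
    simpa using this
  refine tendsto_nhds_unique hlim (hlim2.congr' ?_)
  filter_upwards [hs] with s hs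
  symm
  have := integral_siegelWeight_mul_log_of_lt h0 h1 (w := s * w) (by
    rw [norm_mul, Complex.norm_real, Real.norm_of_nonneg hs.1.le]
    nlinarith [norm_nonneg w, norm_pos_iff.2 hw0])
  exact this

/-! ### Siegel's measure and its potential -/

/-- The parametrization `θ ↦ T |1 + r e^{iθ}|²` of `[T (1 - r)², T (1 + r)²]` by `[0, π]`. -/
def siegelMap (T r θ : ℝ) : ℝ := T * (1 + r ^ 2 + 2 * r * Real.cos θ)

variable {T r : ℝ}

theorem siegelMap_image (hT : 0 < T) (h0 : 0 < r) :
    siegelMap T r '' Ioo 0 Real.pi = Ioo (T * (1 - r) ^ 2) (T * (1 + r) ^ 2) := by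
  have hTr : 0 < T * r := mul_pos hT h0
  ext x
  constructor
  · rintro ⟨θ, hθ, rfl⟩
    have h1 : Real.cos θ < 1 := by
      have := Real.cos_lt_cos_of_nonneg_of_le_pi le_rfl hθ.2.le hθ.1
      simpa using this
    have h2 : -1 < Real.cos θ := by
      have := Real.cos_lt_cos_of_nonneg_of_le_pi hθ.1.le le_rfl hθ.2
      simpa using this
    unfold siegelMap
    constructor <;> nlinarith
  · intro hx
    set c := (x - T * (1 + r ^ 2)) / (2 * (T * r)) with hc
    have hcx : x = T * (1 + r ^ 2 + 2 * r * c) := by rw [hc]; field_simp; ring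
    have h1 : c < 1 := by rw [hc, div_lt_one (by positivity)]; nlinarith [hx.2]
    have h2 : -1 < c := by rw [hc, lt_div_iff₀ (by positivity)]; nlinarith [hx.1]
    refine ⟨Real.arccos c, ⟨Real.arccos_pos.2 h1, ?_⟩, ?_⟩
    · rw [← Real.arccos_neg_one]
      exact Real.strictAntiOn_arccos (by simp) ⟨h2.le, h1.le⟩ h2
    · rw [siegelMap, Real.cos_arccos h2.le h1.le, ← hcx]

theorem siegelMap_injOn (hT : 0 < T) (h0 : 0 < r) : InjOn (siegelMap T r) (Ioo 0 Real.pi) := by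
  intro x hx y hy h
  refine Real.injOn_cos ⟨hx.1.le, hx.2.le⟩ ⟨hy.1.le, hy.2.le⟩ ?_
  unfold siegelMap at h
  have := mul_left_cancel₀ hT.ne' h
  have h2 : (2 * r) ≠ 0 := by positivity
  exact mul_left_cancel₀ h2 (by linarith)

theorem hasDerivAt_siegelMap (T r θ : ℝ) :
    HasDerivAt (siegelMap T r) (-(2 * T * r * Real.sin θ)) θ := by
  have := (((Real.hasDerivAt_cos θ).const_mul (2 * r)).const_add (1 + r ^ 2)).const_mul T
  refine this.congr_deriv ?_
  ring

/-- The density of Siegel's measure. -/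
def siegelDensity (a b x : ℝ) : ℝ :=
  2 * Real.sqrt ((b - x) * (x - a)) / (Real.pi * (a + b - 2 * Real.sqrt (a * b)) * x)

theorem siegelDensity_denom (hT : 0 < T) (h0 : 0 < r) (h1 : r < 1) :
    T * (1 - r) ^ 2 + T * (1 + r) ^ 2 - 2 * Real.sqrt (T * (1 - r) ^ 2 * (T * (1 + r) ^ 2)) =
      4 * r ^ 2 * T := by
  have : T * (1 - r) ^ 2 * (T * (1 + r) ^ 2) = (T * (1 - r ^ 2)) ^ 2 := by ring
  rw [this, Real.sqrt_sq (by have : r ^ 2 < 1 := by nlinarith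
                             exact mul_nonneg hT.le (by linarith))]
  ring

theorem measurable_siegelDensity (a b : ℝ) : Measurable (siegelDensity a b) := by
  unfold siegelDensity
  fun_prop

theorem siegelDensity_bounds (hT : 0 < T) (h0 : 0 < r) (h1 : r < 1) {x : ℝ}
    (hx : x ∈ Icc (T * (1 - r) ^ 2) (T * (1 + r) ^ 2)) :
    0 ≤ siegelDensity (T * (1 - r) ^ 2) (T * (1 + r) ^ 2) x ∧
    siegelDensity (T * (1 - r) ^ 2) (T * (1 + r) ^ 2) x ≤
      2 * (T * (1 + r) ^ 2 - T * (1 - r) ^ 2) /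
        (Real.pi * (4 * r ^ 2 * T) * (T * (1 - r) ^ 2)) := by
  unfold siegelDensity
  rw [siegelDensity_denom hT h0 h1]
  have ha : 0 < T * (1 - r) ^ 2 := by
    have : 0 < 1 - r := by linarith
    positivity
  have hx0 : 0 < x := ha.trans_le hx.1
  refine ⟨by positivity, ?_⟩
  have hs : Real.sqrt ((T * (1 + r) ^ 2 - x) * (x - T * (1 - r) ^ 2)) ≤
      T * (1 + r) ^ 2 - T * (1 - r) ^ 2 := by
    refine Real.sqrt_le_iff.2 ⟨by linarith [hx.1, hx.2], ?_⟩
    rw [sq (T * (1 + r) ^ 2 - T * (1 - r) ^ 2)]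
    exact mul_le_mul (by linarith [hx.1]) (by linarith [hx.2]) (by linarith [hx.1])
      (by linarith [hx.1, hx.2])
  have := hx.1
  have : 0 ≤ T * (1 + r) ^ 2 - T * (1 - r) ^ 2 := (Real.sqrt_nonneg _).trans hs
  gcongr

theorem siegelMeasure_eq (a b : ℝ) : siegelMeasure a b =
    (volume.restrict (Icc a b)).withDensity fun x => ENNReal.ofReal (siegelDensity a b x) := rfl

theorem siegelMeasure_le (hT : 0 < T) (h0 : 0 < r) (h1 : r < 1) :
    ∃ C : ℝ≥0∞, C ≠ ⊤ ∧ siegelMeasure (T * (1 - r) ^ 2) (T * (1 + r) ^ 2) ≤ C • volume := by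
  refine ⟨ENNReal.ofReal (2 * (T * (1 + r) ^ 2 - T * (1 - r) ^ 2) /
    (Real.pi * (4 * r ^ 2 * T) * (T * (1 - r) ^ 2))), ENNReal.ofReal_ne_top, ?_⟩
  rw [siegelMeasure_eq]
  refine (withDensity_mono (ae_restrict_of_forall_mem measurableSet_Icc fun x hx =>
    ENNReal.ofReal_le_ofReal (siegelDensity_bounds hT h0 h1 hx).2)).trans ?_
  rw [withDensity_const]
  gcongr
  exact Measure.restrict_le_self

/-- Integration against Siegel's measure in the parameter `θ`. Both sides are zero when `φ` is not
integrable. -/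
theorem integral_siegelMeasure (hT : 0 < T) (h0 : 0 < r) (h1 : r < 1) (φ : ℝ → ℝ) :
    ∫ x, φ x ∂(siegelMeasure (T * (1 - r) ^ 2) (T * (1 + r) ^ 2)) =
      2 / Real.pi * ∫ θ in 0..Real.pi, siegelWeight r θ * φ (siegelMap T r θ) := by
  rw [siegelMeasure_eq, integral_withDensity_eq_integral_toReal_smul
    (measurable_siegelDensity _ _).ennreal_ofReal
    (Eventually.of_forall fun _ => ENNReal.ofReal_lt_top),
    integral_Icc_eq_integral_Ioo, ← siegelMap_image hT h0,
    integral_image_eq_integral_abs_deriv_smul measurableSet_Ioo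
      (fun θ _ => (hasDerivAt_siegelMap T r θ).hasDerivWithinAt) (siegelMap_injOn hT h0),
    intervalIntegral.integral_of_le Real.pi_pos.le, integral_Ioc_eq_integral_Ioo,
    ← integral_const_mul]
  refine setIntegral_congr_fun measurableSet_Ioo fun θ hθ => ?_
  have hs : 0 < Real.sin θ := Real.sin_pos_of_mem_Ioo hθ
  have hD := siegelWeight_denom_pos h0 h1 θ
  have hsq : (T * (1 + r) ^ 2 - siegelMap T r θ) * (siegelMap T r θ - T * (1 - r) ^ 2) =
      (2 * T * r * Real.sin θ) ^ 2 := by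
    unfold siegelMap
    rw [mul_pow, Real.sin_sq]
    ring
  simp only [smul_eq_mul]
  rw [ENNReal.toReal_ofReal]
  swap
  · have hm : siegelMap T r θ ∈ Ioo (T * (1 - r) ^ 2) (T * (1 + r) ^ 2) := by
      rw [← siegelMap_image hT h0]; exact mem_image_of_mem _ hθ
    exact (siegelDensity_bounds hT h0 h1 (Ioo_subset_Icc_self hm)).1
  have hpos : 0 < 2 * T * r * Real.sin θ := by positivity
  rw [siegelDensity, siegelDensity_denom hT h0 h1, hsq, Real.sqrt_sq hpos.le, abs_neg,
    abs_of_pos hpos, siegelWeight, siegelMap]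
  field_simp
  ring

theorem integral_eq_two_mul_of_symm {f : ℝ → ℝ} (hs : ∀ θ, f (2 * Real.pi - θ) = f θ)
    (hi : IntervalIntegrable f volume 0 (2 * Real.pi)) :
    ∫ θ in 0..2 * Real.pi, f θ = 2 * ∫ θ in 0..Real.pi, f θ := by
  have hp := Real.pi_pos
  have h1 : IntervalIntegrable f volume 0 Real.pi := hi.mono_set (by
    rw [uIcc_of_le hp.le, uIcc_of_le (by linarith)]
    exact Icc_subset_Icc le_rfl (by linarith))
  have h2 : IntervalIntegrable f volume Real.pi (2 * Real.pi) := hi.mono_set (by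
    rw [uIcc_of_le (by linarith), uIcc_of_le (by linarith)]
    exact Icc_subset_Icc hp.le le_rfl)
  rw [← intervalIntegral.integral_add_adjacent_intervals h1 h2]
  have := intervalIntegral.integral_comp_sub_left (a := 0) (b := Real.pi) f (2 * Real.pi)
  simp only [hs] at this
  rw [show 2 * Real.pi - Real.pi = Real.pi by ring, sub_zero] at this
  linarith

theorem siegelWeight_symm (r θ : ℝ) : siegelWeight r (2 * Real.pi - θ) = siegelWeight r θ := by
  unfold siegelWeight
  rw [Real.sin_two_pi_sub, Real.cos_two_pi_sub]
  ring

theorem siegelMeasure_compl (a b : ℝ) : siegelMeasure a b (Icc a b)ᶜ = 0 := by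
  rw [siegelMeasure_eq]
  refine withDensity_absolutelyContinuous _ _ ?_
  rw [Measure.restrict_apply measurableSet_Icc.compl]
  simp

theorem isProbabilityMeasure_siegelMeasure (hT : 0 < T) (h0 : 0 < r) (h1 : r < 1) :
    IsProbabilityMeasure (siegelMeasure (T * (1 - r) ^ 2) (T * (1 + r) ^ 2)) := by
  obtain ⟨C, hC, hle⟩ := siegelMeasure_le hT h0 h1
  have hfin : siegelMeasure (T * (1 - r) ^ 2) (T * (1 + r) ^ 2) univ ≠ ⊤ := by
    rw [← measure_add_measure_compl (measurableSet_Icc (a := T * (1 - r) ^ 2)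
      (b := T * (1 + r) ^ 2)), siegelMeasure_compl, add_zero]
    refine ne_top_of_le_ne_top ?_ (hle _)
    rw [Measure.smul_apply, Real.volume_Icc, smul_eq_mul]
    exact ENNReal.mul_ne_top hC ENNReal.ofReal_ne_top
  have h := integral_siegelMeasure hT h0 h1 (fun _ => 1)
  have h2 := integral_eq_two_mul_of_symm (siegelWeight_symm r)
    ((continuous_siegelWeight h0 h1).intervalIntegrable _ _)
  rw [integral_siegelWeight h0 h1] at h2
  simp only [mul_one, integral_const, smul_eq_mul] at h
  have h3 : 2 / Real.pi * ∫ θ in 0..Real.pi, siegelWeight r θ = 1 := by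
    rw [div_mul_eq_mul_div, ← h2, div_self Real.pi_ne_zero]
  rw [h3, measureReal_def] at h
  constructor
  rw [← ENNReal.ofReal_toReal hfin, h, ENNReal.ofReal_one]

theorem ae_mem_Icc_siegelMeasure (a b : ℝ) : ∀ᵐ x ∂(siegelMeasure a b), x ∈ Icc a b :=
  siegelMeasure_compl a b

theorem integrable_id_siegelMeasure (hT : 0 < T) (h0 : 0 < r) (h1 : r < 1) :
    Integrable (fun x : ℝ => x) (siegelMeasure (T * (1 - r) ^ 2) (T * (1 + r) ^ 2)) := by
  have := isProbabilityMeasure_siegelMeasure hT h0 h1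
  refine Integrable.of_bound (C := T * (1 + r) ^ 2) (by fun_prop) ?_
  filter_upwards [ae_mem_Icc_siegelMeasure (T * (1 - r) ^ 2) (T * (1 + r) ^ 2)] with x hx
  rw [Real.norm_of_nonneg ((by positivity : 0 ≤ T * (1 - r) ^ 2).trans hx.1)]
  exact hx.2

theorem integral_id_siegelMeasure (hT : 0 < T) (h0 : 0 < r) (h1 : r < 1) :
    ∫ x, x ∂(siegelMeasure (T * (1 - r) ^ 2) (T * (1 + r) ^ 2)) = T := by
  rw [integral_siegelMeasure hT h0 h1 (fun x => x)]
  have : ∀ θ, siegelWeight r θ * siegelMap T r θ = T * Real.sin θ ^ 2 := fun θ => by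
    have := (siegelWeight_denom_pos h0 h1 θ).ne'
    rw [siegelWeight, siegelMap, div_mul_eq_mul_div, div_eq_iff this]
    ring
  simp only [this]
  rw [intervalIntegral.integral_const_mul, integral_sin_sq]
  simp
  field_simp

/-- The logarithmic potential of Siegel's measure at `x = T (1 + r² + r (w + 1 / w))`, where `w`
lies in the closed unit disc; `|w| = 1` corresponds to points of the support. -/
theorem integral_log_sub_siegelMeasure (hT : 0 < T) (h0 : 0 < r) (h1 : r < 1) {x : ℝ} {w : ℂ}
    (hw0 : w ≠ 0) (hw1 : ‖w‖ ≤ 1) (hx : (x : ℂ) = T * (1 + r ^ 2 + r * (w + w⁻¹))) :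
    ∫ y, Real.log |x - y| ∂(siegelMeasure (T * (1 - r) ^ 2) (T * (1 + r) ^ 2)) =
      Real.log (T * r) - Real.log ‖w‖ + w.re / r - (1 - r ^ 2) / r ^ 2 * Real.log ‖1 + w * r‖ := by
  rw [integral_siegelMeasure hT h0 h1]
  set L : ℝ → ℝ := fun θ => Real.log ‖1 - w * circleMap 0 1 θ‖ with hL
  set c : ℝ := Real.log (T * r) - Real.log ‖w‖ with hc
  have hTr : 0 < T * r := mul_pos hT h0
  have hnw : 0 < ‖w‖ := norm_pos_iff.2 hw0
  have hLi : IntervalIntegrable L volume 0 (2 * Real.pi) := circleIntegrable_log_norm_one_sub w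
  have hLi' : IntervalIntegrable (fun θ => L (2 * Real.pi - θ)) volume 0 (2 * Real.pi) := by
    have := hLi.comp_sub_left (2 * Real.pi)
    simpa using this.symm
  have hgc := continuous_siegelWeight h0 h1
  have hconj : ∀ θ, circleMap 0 1 (2 * Real.pi - θ) = (circleMap 0 1 θ)⁻¹ := fun θ => by
    simp only [circleMap, Complex.ofReal_one, one_mul, zero_add]
    rw [← Complex.exp_neg]
    push_cast
    rw [show ((2 : ℂ) * Real.pi - θ) * Complex.I = 2 * Real.pi * Complex.I - θ * Complex.I by ring,
      Complex.exp_sub, Complex.exp_two_pi_mul_I, one_div, Complex.exp_neg]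
  have hcos : ∀ θ : ℝ, circleMap 0 1 θ + (circleMap 0 1 θ)⁻¹ = ((2 * Real.cos θ : ℝ) : ℂ) :=
      fun θ => by
    simp only [circleMap, Complex.ofReal_one, one_mul, zero_add]
    rw [← Complex.exp_neg]
    push_cast
    rw [Complex.two_cos, neg_mul]
  -- the kernel splits off the constant `c` and two conjugate factors
  have hae : ∀ᵐ θ : ℝ, siegelWeight r θ * Real.log |x - siegelMap T r θ| =
      siegelWeight r θ * (c + L θ + L (2 * Real.pi - θ)) := by
    have hcn := ((((countable_singleton w⁻¹).union (countable_singleton w))).preimage_circleMap 0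
      one_ne_zero).measure_zero volume
    filter_upwards [measure_eq_zero_iff_ae_notMem.1 hcn] with θ hθ
    simp only [mem_preimage, mem_union, mem_singleton_iff, not_or] at hθ
    set z := circleMap 0 1 θ with hz
    have hz0 : z ≠ 0 := by
      intro h
      have : ‖z‖ = 1 := by simp [hz]
      simp [h] at this
    have f1 : 1 - w * z ≠ 0 := fun h => hθ.1 (eq_inv_of_mul_eq_one_right (by linear_combination -h))
    have f2 : 1 - w * z⁻¹ ≠ 0 := fun h => hθ.2 (by field_simp at h; linear_combination h)
    have e : ((x - siegelMap T r θ : ℝ) : ℂ) = (T * r : ℝ) * w⁻¹ * (1 - w * z) * (1 - w * z⁻¹) := by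
      have hcz := hcos θ
      rw [← hz] at hcz
      unfold siegelMap
      push_cast at hcz ⊢
      rw [hx]
      have : (T : ℂ) * (1 + r ^ 2 + 2 * r * Complex.cos θ) =
        T * (1 + r ^ 2 + r * (z + z⁻¹)) := by rw [hcz]; ring
      rw [this]
      field_simp
      ring
    have e2 : |x - siegelMap T r θ| = T * r * ‖w‖⁻¹ * ‖1 - w * z‖ * ‖1 - w * z⁻¹‖ := by
      rw [← Real.norm_eq_abs, ← Complex.norm_real, e]
      simp only [norm_mul, norm_inv, Complex.norm_real, Real.norm_eq_abs, abs_of_pos hT,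
        abs_of_pos h0]
    have g1 := norm_ne_zero_iff.2 f1
    have g2 := norm_ne_zero_iff.2 f2
    rw [e2, Real.log_mul (by positivity) g2, Real.log_mul (by positivity) g1,
      Real.log_mul hTr.ne' (by positivity), Real.log_inv]
    simp only [hL, hconj, ← hz, hc]
    ring
  have e1 : ∫ θ in 0..Real.pi, siegelWeight r θ * Real.log |x - siegelMap T r θ| =
      ∫ θ in 0..Real.pi, siegelWeight r θ * (c + L θ + L (2 * Real.pi - θ)) :=
    intervalIntegral.integral_congr_ae (by filter_upwards [hae] with θ hθ _ using hθ)
  have e2 := integral_eq_two_mul_of_symm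
    (f := fun θ => siegelWeight r θ * (c + L θ + L (2 * Real.pi - θ)))
    (fun θ => by rw [siegelWeight_symm, sub_sub_cancel]; ring)
    (((intervalIntegrable_const.add hLi).add hLi').continuousOn_mul hgc.continuousOn)
  have i1 : ∫ θ in 0..2 * Real.pi, siegelWeight r θ * L θ = _ :=
    integral_siegelWeight_mul_log h0 h1 hw1
  have i2 : ∫ θ in 0..2 * Real.pi, siegelWeight r θ * L (2 * Real.pi - θ) =
      ∫ θ in 0..2 * Real.pi, siegelWeight r θ * L θ := by
    have := intervalIntegral.integral_comp_sub_left (a := 0) (b := 2 * Real.pi)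
      (fun θ => siegelWeight r θ * L θ) (2 * Real.pi)
    simp only [siegelWeight_symm, sub_self, sub_zero] at this
    exact this
  have e3 : ∫ θ in 0..2 * Real.pi, siegelWeight r θ * (c + L θ + L (2 * Real.pi - θ)) =
      c * Real.pi + 2 * (2 * Real.pi * (w.re / (4 * r) -
        (1 - r ^ 2) / (4 * r ^ 2) * Real.log ‖1 + w * r‖)) := by
    have j0 : IntervalIntegrable (fun θ => c * siegelWeight r θ) volume 0 (2 * Real.pi) :=
      (hgc.const_mul c).intervalIntegrable _ _
    have j1 : IntervalIntegrable (fun θ => siegelWeight r θ * L θ) volume 0 (2 * Real.pi) :=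
      hLi.continuousOn_mul hgc.continuousOn
    have j2 : IntervalIntegrable (fun θ => siegelWeight r θ * L (2 * Real.pi - θ)) volume 0
      (2 * Real.pi) := hLi'.continuousOn_mul hgc.continuousOn
    have : ∀ θ, siegelWeight r θ * (c + L θ + L (2 * Real.pi - θ)) = c * siegelWeight r θ +
      siegelWeight r θ * L θ + siegelWeight r θ * L (2 * Real.pi - θ) := fun θ => by ring
    simp only [this]
    rw [intervalIntegral.integral_add (j0.add j1) j2, intervalIntegral.integral_add j0 j1,
      intervalIntegral.integral_const_mul, integral_siegelWeight h0 h1, i2, i1]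
    ring
  rw [e1]
  rw [e3] at e2
  have e4 : ∫ θ in 0..Real.pi, siegelWeight r θ * (c + L θ + L (2 * Real.pi - θ)) =
    (c * Real.pi + 2 * (2 * Real.pi * (w.re / (4 * r) -
        (1 - r ^ 2) / (4 * r ^ 2) * Real.log ‖1 + w * r‖))) / 2 := by linarith
  rw [e4]
  have := Real.pi_ne_zero
  field_simp
  ring

/-! ### The pointwise inequality off the support -/

/-- Real numbers outside `[-2, 2]` are Joukowski images of points of the real unit interval. -/
theorem exists_joukowski (m : ℝ) (hm : 2 < |m|) : ∃ u : ℝ, u ≠ 0 ∧ |u| < 1 ∧ m = u + u⁻¹ := by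
  have key : ∀ m : ℝ, 2 < m → ∃ u : ℝ, u ≠ 0 ∧ |u| < 1 ∧ m = u + u⁻¹ := by
    intro m hm
    have hs : Real.sqrt (m ^ 2 - 4) ^ 2 = m ^ 2 - 4 := Real.sq_sqrt (by nlinarith)
    set s := Real.sqrt (m ^ 2 - 4)
    have hs0 : 0 ≤ s := Real.sqrt_nonneg _
    have hsm : s < m := by nlinarith
    have hs2 : m - 2 < s := by nlinarith
    have hu : (m - s) / 2 ≠ 0 := by
      have : 0 < m - s := by linarith
      positivity
    refine ⟨(m - s) / 2, hu, by rw [abs_lt]; constructor <;> linarith, ?_⟩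
    have : ((m - s) / 2)⁻¹ = (m + s) / 2 := by
      rw [inv_eq_iff_eq_inv, eq_comm, inv_eq_of_mul_eq_one_left]
      nlinarith
    rw [this]; ring
  rcases lt_abs.1 hm with h | h
  · exact key m h
  · obtain ⟨u, hu0, hu1, hu⟩ := key (-m) h
    exact ⟨-u, neg_ne_zero.2 hu0, by rwa [abs_neg], by rw [inv_neg]; linarith⟩

/-- The excess `x - T - T (1 - r²) log x - 2 r² T U(x)` off the support, divided by `T`, as a
function of the real parameter `u` with `x = T (u + r) (1 + r u) / u` and `0 < |u| < 1`. `Real.log`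
takes the absolute value of its argument, so the same formula serves `u > 0` (right of the support) and
`-1 < u < -r` (left of it). -/
def siegelExcess (r u : ℝ) : ℝ :=
  r * (u⁻¹ - u) + (1 - r ^ 2) * (Real.log (1 + r * u) - Real.log (u + r)) +
    (1 + r ^ 2) * Real.log u

theorem hasDerivAt_siegelExcess {u : ℝ} (hu : u ≠ 0) (h1 : 1 + r * u ≠ 0) (h2 : u + r ≠ 0) :
    HasDerivAt (siegelExcess r)
      (-(r ^ 2 * (1 - u ^ 2) ^ 2) / (u ^ 2 * ((u + r) * (1 + r * u)))) u := by
  have d1 := ((hasDerivAt_inv hu).sub (hasDerivAt_id u)).const_mul r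
  have d2 := (((hasDerivAt_id u).const_mul r).const_add 1).log h1
  have d3 := ((hasDerivAt_id u).add_const r).log h2
  have d4 := (Real.hasDerivAt_log hu).const_mul (1 + r ^ 2)
  refine ((d1.add ((d2.sub d3).const_mul (1 - r ^ 2))).add d4).congr_deriv ?_
  simp only [id]
  field_simp
  ring

theorem siegelExcess_nonneg_of_pos (h0 : 0 < r) {u : ℝ} (hu0 : 0 < u) (hu1 : u ≤ 1) :
    0 ≤ siegelExcess r u := by
  have hd : ∀ v ∈ Icc u 1, HasDerivAt (siegelExcess r)
      (-(r ^ 2 * (1 - v ^ 2) ^ 2) / (v ^ 2 * ((v + r) * (1 + r * v)))) v := fun v hv => by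
    have : 0 < v := hu0.trans_le hv.1
    exact hasDerivAt_siegelExcess (by positivity) (by positivity) (by positivity)
  have ha : AntitoneOn (siegelExcess r) (Icc u 1) := by
    refine antitoneOn_of_deriv_nonpos (convex_Icc _ _)
      (fun v hv => (hd v hv).continuousAt.continuousWithinAt)
      (fun v hv => (hd v (interior_subset hv)).differentiableAt.differentiableWithinAt)
      fun v hv => ?_
    have hv' := interior_subset hv
    rw [(hd v hv').deriv]
    have : 0 < v := hu0.trans_le hv'.1
    exact div_nonpos_of_nonpos_of_nonneg (neg_nonpos.2 (by positivity)) (by positivity)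
  have := ha ⟨le_rfl, hu1⟩ ⟨hu1, le_rfl⟩ hu1
  refine le_trans (le_of_eq ?_) this
  simp [siegelExcess, add_comm]

theorem siegelExcess_nonneg_of_neg (h0 : 0 < r) (h1 : r < 1) {u : ℝ} (hu0 : -1 ≤ u) (hu1 : u < -r) :
    0 ≤ siegelExcess r u := by
  have hsign : ∀ v ∈ Icc (-1) u, v < 0 ∧ v + r < 0 ∧ 0 < 1 + r * v := fun v hv =>
    ⟨by linarith [hv.2], by linarith [hv.2], by nlinarith [hv.1]⟩
  have hd : ∀ v ∈ Icc (-1) u, HasDerivAt (siegelExcess r)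
      (-(r ^ 2 * (1 - v ^ 2) ^ 2) / (v ^ 2 * ((v + r) * (1 + r * v)))) v := fun v hv => by
    obtain ⟨a, b, c⟩ := hsign v hv
    exact hasDerivAt_siegelExcess a.ne c.ne' b.ne
  have ha : MonotoneOn (siegelExcess r) (Icc (-1) u) := by
    refine monotoneOn_of_deriv_nonneg (convex_Icc _ _)
      (fun v hv => (hd v hv).continuousAt.continuousWithinAt)
      (fun v hv => (hd v (interior_subset hv)).differentiableAt.differentiableWithinAt)
      fun v hv => ?_
    have hv' := interior_subset hv
    rw [(hd v hv').deriv]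
    obtain ⟨a, b, c⟩ := hsign v hv'
    refine div_nonneg_of_nonpos (neg_nonpos.2 (by positivity)) ?_
    exact mul_nonpos_of_nonneg_of_nonpos (sq_nonneg _) (mul_nonpos_of_nonpos_of_nonneg b.le c.le)
  have := ha ⟨le_rfl, hu0⟩ ⟨hu0, le_rfl⟩ hu0
  refine le_trans (le_of_eq ?_) this
  have e : Real.log (-1 + r) = Real.log (1 + r * -1) := by
    rw [← Real.log_neg_eq_log]; congr 1; ring
  simp only [siegelExcess, e]
  simp

theorem norm_one_add_exp_mul (r φ : ℝ) :
    ‖1 + Complex.exp (φ * Complex.I) * r‖ ^ 2 = 1 + r ^ 2 + 2 * r * Real.cos φ := by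
  rw [← Complex.normSq_eq_norm_sq, Complex.normSq_apply]
  simp [Complex.exp_ofReal_mul_I_re, Complex.exp_ofReal_mul_I_im]
  nlinarith [Real.sin_sq_add_cos_sq φ]

/-- On the support `w = e^{iφ}`, where `x = T |1 + r w|²` expresses `log |1 + r w|` through
`log x`. -/
theorem siegelMeasure_equality (hT : 0 < T) (h0 : 0 < r) (h1 : r < 1)
    (hE : (1 + r ^ 2) * Real.log T + 2 * r ^ 2 * Real.log r = r ^ 2) {x : ℝ}
    (hx : x ∈ Icc (T * (1 - r) ^ 2) (T * (1 + r) ^ 2)) :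
    T + T * (1 - r ^ 2) * Real.log x + 2 * r ^ 2 * T *
      ∫ y, Real.log |x - y| ∂(siegelMeasure (T * (1 - r) ^ 2) (T * (1 + r) ^ 2)) = x := by
  have hTr : 0 < T * r := mul_pos hT h0
  have hx0 : 0 < x := lt_of_lt_of_le (by have : 0 < 1 - r := by linarith
                                         positivity) hx.1
  set c := (x - T * (1 + r ^ 2)) / (2 * (T * r)) with hc
  have hcx : x = T * (1 + r ^ 2 + 2 * r * c) := by rw [hc]; field_simp; ring
  have hc1 : c ≤ 1 := by rw [hc, div_le_one (by positivity)]; nlinarith [hx.2]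
  have hc2 : -1 ≤ c := by rw [hc, le_div_iff₀ (by positivity)]; nlinarith [hx.1]
  set φ := Real.arccos c with hφ
  have hcos : Real.cos φ = c := Real.cos_arccos hc2 hc1
  set w := Complex.exp (φ * Complex.I) with hw
  have hw1 : ‖w‖ = 1 := Complex.norm_exp_ofReal_mul_I φ
  have hww : w + w⁻¹ = ((2 * c : ℝ) : ℂ) := by
    rw [hw, ← Complex.exp_neg, ← hcos]
    push_cast
    rw [Complex.two_cos, neg_mul]
  have hwre : w.re = c := by rw [hw, Complex.exp_ofReal_mul_I_re, hcos]
  have hn := norm_one_add_exp_mul r φ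
  rw [← hw, hcos] at hn
  have hxn : x = T * ‖1 + w * r‖ ^ 2 := by rw [hn, hcx]
  have hnpos : ‖1 + w * r‖ ≠ 0 := fun h => by rw [h] at hxn; simp at hxn; linarith
  have hlog : Real.log x = Real.log T + 2 * Real.log ‖1 + w * r‖ := by
    rw [hxn, Real.log_mul hT.ne' (by positivity), Real.log_pow]
    push_cast; ring
  rw [integral_log_sub_siegelMeasure hT h0 h1 (w := w) (Complex.exp_ne_zero _) hw1.le
    (by rw [hww]; conv_lhs => rw [hcx]
        push_cast; ring), hw1, hwre, hlog, Real.log_mul hT.ne' h0.ne', Real.log_one]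
  conv_rhs => rw [hcx]
  field_simp
  linear_combination hE

theorem siegelMeasure_inequality (hT : 0 < T) (h0 : 0 < r) (h1 : r < 1)
    (hE : (1 + r ^ 2) * Real.log T + 2 * r ^ 2 * Real.log r = r ^ 2) {x : ℝ}
    (hx : 0 < x) :
    T + T * (1 - r ^ 2) * Real.log x + 2 * r ^ 2 * T *
      ∫ y, Real.log |x - y| ∂(siegelMeasure (T * (1 - r) ^ 2) (T * (1 + r) ^ 2)) ≤ x := by
  by_cases hmem : x ∈ Icc (T * (1 - r) ^ 2) (T * (1 + r) ^ 2)
  · exact (siegelMeasure_equality hT h0 h1 hE hmem).le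
  have hTr : 0 < T * r := mul_pos hT h0
  set m := (x - T * (1 + r ^ 2)) / (T * r) with hm
  have hxm : x = T * (1 + r ^ 2 + r * m) := by rw [hm]; field_simp; ring
  have hm2 : 2 < |m| := by
    by_contra! h
    obtain ⟨ha, hb⟩ := abs_le.1 h
    refine hmem ⟨?_, ?_⟩ <;> nlinarith
  obtain ⟨u, hu0, hu1, hu⟩ := exists_joukowski m hm2
  obtain ⟨hul, huu⟩ := abs_lt.1 hu1
  have hru : 0 < 1 + r * u := by nlinarith
  have hxu : x * u = T * ((u + r) * (1 + r * u)) := by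
    rw [hxm, hu]; field_simp; ring
  have hex : 0 ≤ siegelExcess r u := by
    rcases lt_or_gt_of_ne hu0 with hneg | hpos
    · refine siegelExcess_nonneg_of_neg h0 h1 hul.le ?_
      by_contra! h
      have h3 : x * u < 0 := mul_neg_of_pos_of_neg hx hneg
      have h4 : 0 ≤ T * ((u + r) * (1 + r * u)) :=
        mul_nonneg hT.le (mul_nonneg (by linarith) hru.le)
      linarith
    · exact siegelExcess_nonneg_of_pos h0 hpos huu.le
  have hur : u + r ≠ 0 := fun h => by
    rw [h] at hxu
    simp [hx.ne', hu0] at hxu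
  have hlog : Real.log x = Real.log T + Real.log (u + r) + Real.log (1 + r * u) - Real.log u := by
    have : x = T * ((u + r) * (1 + r * u)) / u := by rw [← hxu]; field_simp
    rw [this, Real.log_div (by positivity) hu0, Real.log_mul hT.ne' (by positivity),
      Real.log_mul hur hru.ne']
    ring
  have hn1 : ‖(1 : ℂ) + (u : ℂ) * r‖ = 1 + r * u := by
    rw [show (1 : ℂ) + (u : ℂ) * r = ((1 + r * u : ℝ) : ℂ) by push_cast; ring, Complex.norm_real,
      Real.norm_of_nonneg hru.le]
  rw [integral_log_sub_siegelMeasure hT h0 h1 (w := u) (by exact_mod_cast hu0)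
    (by simpa using hu1.le) (by conv_lhs => rw [hxm, hu]
                                push_cast; ring), hn1, Complex.norm_real, Real.norm_eq_abs,
    Real.log_abs, Complex.ofReal_re, hlog, Real.log_mul hT.ne' h0.ne', ← sub_nonneg]
  have : T * siegelExcess r u ≥ 0 := mul_nonneg hT.le hex
  refine this.le.trans (le_of_eq ?_)
  rw [hxm, hu]
  unfold siegelExcess
  field_simp
  linear_combination u * hE

/-- The potential at the origin, which corresponds to `w = -r`. -/
theorem integral_log_siegelMeasure (hT : 0 < T) (h0 : 0 < r) (h1 : r < 1)
    (hL : Real.log T = 1 + (1 - r ^ 2) / r ^ 2 * Real.log (1 - r ^ 2)) :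
    ∫ y, Real.log |y| ∂(siegelMeasure (T * (1 - r) ^ 2) (T * (1 + r) ^ 2)) = 0 := by
  have hr2 : 0 < 1 - r ^ 2 := by nlinarith
  have h := integral_log_sub_siegelMeasure hT h0 h1 (x := 0) (w := -r)
    (by simpa using h0.ne') (by simp [abs_of_pos h0, h1.le]) (by
      have : (r : ℂ) ≠ 0 := by exact_mod_cast h0.ne'
      push_cast
      field_simp
      ring)
  have hn1 : ‖(1 : ℂ) + -(r : ℂ) * r‖ = 1 - r ^ 2 := by
    rw [show (1 : ℂ) + -(r : ℂ) * r = ((1 - r ^ 2 : ℝ) : ℂ) by push_cast; ring, Complex.norm_real,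
      Real.norm_of_nonneg hr2.le]
  simp only [zero_sub, abs_neg] at h
  rw [h, hn1, norm_neg, Complex.norm_real, Real.norm_of_nonneg h0.le,
    Real.log_mul hT.ne' h0.ne', hL]
  simp
  field_simp
  ring

/-! ### Siegel's equation -/

theorem log_one_add_inv {x : ℝ} (hx : 0 < x) :
    Real.log (1 + x⁻¹) = Real.log (1 + x) - Real.log x := by
  rw [← Real.log_div (by positivity) hx.ne']
  congr 1
  field_simp
  ring

theorem inv_one_add_lt_log_sub_log {x : ℝ} (hx : 0 < x) :
    (1 + x)⁻¹ < Real.log (1 + x) - Real.log x := by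
  have h := Real.log_lt_sub_one_of_pos (x := x / (1 + x)) (by positivity)
    (by rw [Ne, div_eq_one_iff_eq (by positivity)]; linarith)
  rw [Real.log_div hx.ne' (by positivity)] at h
  have : x / (1 + x) - 1 = -(1 + x)⁻¹ := by field_simp; ring
  linarith

/-- The left side of Siegel's equation minus its right side, with `log (1 + x⁻¹)` written as a
difference of logarithms. -/
def siegelFun (x : ℝ) : ℝ :=
  (1 + x) * (Real.log (1 + x) - Real.log x) + Real.log x / (1 + x) - 1

theorem isSiegelRoot_iff {x : ℝ} : IsSiegelRoot x ↔ 0 < x ∧ siegelFun x = 0 := by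
  refine and_congr_right fun hx => ?_
  rw [siegelFun, log_one_add_inv hx, sub_eq_zero]

theorem continuousOn_siegelFun : ContinuousOn siegelFun (Ioi 0) := by
  unfold siegelFun
  refine ContinuousOn.sub (ContinuousOn.add (ContinuousOn.mul (by fun_prop) (ContinuousOn.sub
    (ContinuousOn.log (by fun_prop) ?_) (ContinuousOn.log (by fun_prop) ?_)))
    (ContinuousOn.div (ContinuousOn.log (by fun_prop) ?_) (by fun_prop) ?_)) (by fun_prop) <;>
  · intro x hx
    have : (0 : ℝ) < x := hx
    positivity

theorem strictMonoOn_siegelFun : StrictMonoOn siegelFun (Ioc 0 1) := by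
  refine strictMonoOn_of_deriv_pos (convex_Ioc 0 1)
    (continuousOn_siegelFun.mono Ioc_subset_Ioi_self) fun x hx => ?_
  rw [interior_Ioc] at hx
  have h0 : 0 < x := hx.1
  have h1 : (1 + x) ≠ 0 := by positivity
  have hl : HasDerivAt (fun x : ℝ => Real.log (1 + x)) (1 / (1 + x)) x :=
    ((hasDerivAt_id x).const_add 1).log h1
  have hd := ((((hasDerivAt_id x).const_add 1).mul (hl.sub (Real.hasDerivAt_log h0.ne'))).add
    ((Real.hasDerivAt_log h0.ne').div ((hasDerivAt_id x).const_add 1) h1)).sub_const 1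
  have hd' : HasDerivAt siegelFun
      ((Real.log (1 + x) - Real.log x - (1 + x)⁻¹) - Real.log x / (1 + x) ^ 2) x := by
    refine hd.congr_deriv ?_
    simp
    field_simp
    ring
  rw [hd'.deriv]
  have h2 := inv_one_add_lt_log_sub_log h0
  have h3 : Real.log x / (1 + x) ^ 2 ≤ 0 :=
    div_nonpos_of_nonpos_of_nonneg (Real.log_nonpos h0.le hx.2.le) (sq_nonneg _)
  linarith

theorem siegelFun_pos {x : ℝ} (hx : 1 ≤ x) : 0 < siegelFun x := by
  have h0 : 0 < x := by linarith
  have h2 := inv_one_add_lt_log_sub_log h0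
  have h3 : 0 ≤ Real.log x / (1 + x) := div_nonneg (Real.log_nonneg hx) (by linarith)
  have h4 : 1 < (1 + x) * (Real.log (1 + x) - Real.log x) := by
    calc 1 = (1 + x) * (1 + x)⁻¹ := by field_simp
      _ < _ := by gcongr
  unfold siegelFun
  linarith

theorem strictMonoOn_mul_log_sub_log :
    StrictMonoOn (fun x : ℝ => x * (Real.log (1 + x) - Real.log x)) (Ioi 0) := by
  have hd : ∀ x ∈ Ioi (0 : ℝ), HasDerivAt (fun x : ℝ => x * (Real.log (1 + x) - Real.log x))
      (Real.log (1 + x) - Real.log x - (1 + x)⁻¹) x := by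
    intro x hx
    have h0 : 0 < x := hx
    have hl : HasDerivAt (fun x : ℝ => Real.log (1 + x)) (1 / (1 + x)) x :=
      ((hasDerivAt_id x).const_add 1).log (by positivity)
    refine ((hasDerivAt_id x).mul (hl.sub (Real.hasDerivAt_log h0.ne'))).congr_deriv ?_
    simp
    field_simp
    ring
  refine strictMonoOn_of_deriv_pos (convex_Ioi 0)
    (fun x hx => (hd x hx).continuousAt.continuousWithinAt) fun x hx => ?_
  rw [interior_Ioi] at hx
  rw [(hd x hx).deriv]
  linarith [inv_one_add_lt_log_sub_log (mem_Ioi.1 hx)]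

/-- Two-sided rational bounds for `log ((1 + y) / (1 - y))` from six terms of its odd power
series. -/
theorem log_div_bounds {y : ℝ} (h0 : 0 ≤ y) (h1 : y < 1) :
    2 * ∑ i ∈ Finset.range 6, y ^ (2 * i + 1) / (2 * i + 1) ≤ Real.log ((1 + y) / (1 - y)) ∧
    Real.log ((1 + y) / (1 - y)) ≤
      2 * (∑ i ∈ Finset.range 6, y ^ (2 * i + 1) / (2 * i + 1) + y ^ 13 / (1 - y ^ 2)) := by
  have a := Real.sum_range_le_log_div h0 h1 6
  have b := Real.log_div_le_sum_range_add h0 h1 6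
  norm_num at a b ⊢
  constructor <;> linarith

/-- A power of two is split off so that the remaining logarithm has a rapidly convergent series. -/
theorem log_sub_log_lower_eq : Real.log (1 + 0.31448084) - Real.log 0.31448084 =
    2 * Real.log 2 + Real.log
      ((1 + (1.31448084 - 1.25792336) / (1.31448084 + 1.25792336)) /
        (1 - (1.31448084 - 1.25792336) / (1.31448084 + 1.25792336))) := by
    rw [← Real.log_div (by norm_num) (by norm_num), ← Real.log_rpow (by norm_num),
      ← Real.log_mul (by norm_num) (by norm_num)]
    norm_num

/-- The root is `0.3144808694…`; this endpoint and that of `siegelFun_upper_pos` are close enough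
to it for `T = 1.73361051698…` to stay between `1.7336105` and `1.7336106`. -/
theorem siegelFun_lower_neg : siegelFun 0.31448084 < 0 := by
  have A := (log_div_bounds (y := (1.31448084 - 1.25792336) / (1.31448084 + 1.25792336))
    (by norm_num) (by norm_num)).2
  have B := (log_div_bounds (y := 0.25792336 / 2.25792336) (by norm_num) (by norm_num)).2
  have e2 : Real.log 0.31448084 = -2 * Real.log 2 + Real.log
      ((1 + 0.25792336 / 2.25792336) / (1 - 0.25792336 / 2.25792336)) := by
    rw [← Real.log_rpow (by norm_num), ← Real.log_mul (by norm_num) (by norm_num)]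
    norm_num
  have hl := Real.log_two_lt_d9
  unfold siegelFun
  rw [log_sub_log_lower_eq, e2]
  norm_num [Finset.sum_range_succ] at A B ⊢
  linarith

theorem log_sub_log_upper_eq : Real.log (1 + 0.314480876) - Real.log 0.314480876 =
    2 * Real.log 2 + Real.log
      ((1 + (1.314480876 - 1.257923504) / (1.314480876 + 1.257923504)) /
        (1 - (1.314480876 - 1.257923504) / (1.314480876 + 1.257923504))) := by
  rw [← Real.log_div (by norm_num) (by norm_num), ← Real.log_rpow (by norm_num),
    ← Real.log_mul (by norm_num) (by norm_num)]
  norm_num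

theorem siegelFun_upper_pos : 0 < siegelFun 0.314480876 := by
  have A := (log_div_bounds (y := (1.314480876 - 1.257923504) / (1.314480876 + 1.257923504))
    (by norm_num) (by norm_num)).1
  have B := (log_div_bounds (y := 0.257923504 / 2.257923504) (by norm_num) (by norm_num)).1
  have e2 : Real.log 0.314480876 = -2 * Real.log 2 + Real.log
      ((1 + 0.257923504 / 2.257923504) / (1 - 0.257923504 / 2.257923504)) := by
    rw [← Real.log_rpow (by norm_num), ← Real.log_mul (by norm_num) (by norm_num)]
    norm_num
  have hl := Real.log_two_gt_d9
  unfold siegelFun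
  rw [log_sub_log_upper_eq, e2]
  norm_num [Finset.sum_range_succ] at A B ⊢
  linarith

theorem existsUnique_isSiegelRoot : ∃! x : ℝ, IsSiegelRoot x := by
  obtain ⟨x, hx, hx0⟩ : (0 : ℝ) ∈ siegelFun '' Icc 0.31448084 0.314480876 :=
    intermediate_value_Icc (by norm_num)
      (continuousOn_siegelFun.mono fun y hy => lt_of_lt_of_le (by norm_num) hy.1)
      ⟨siegelFun_lower_neg.le, siegelFun_upper_pos.le⟩
  have hx' : 0 < x := lt_of_lt_of_le (by norm_num) hx.1
  refine ⟨x, isSiegelRoot_iff.2 ⟨hx', hx0⟩, fun y hy => ?_⟩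
  obtain ⟨hy0, hy⟩ := isSiegelRoot_iff.1 hy
  have hy1 : y ≤ 1 := by
    by_contra! h
    exact (siegelFun_pos h.le).ne' hy
  exact strictMonoOn_siegelFun.injOn ⟨hy0, hy1⟩ ⟨hx', hx.2.trans (by norm_num)⟩ (hy.trans hx0.symm)

theorem IsSiegelRoot.mem_Ioo {x : ℝ} (h : IsSiegelRoot x) : x ∈ Ioo 0.31448084 0.314480876 := by
  obtain ⟨h0, h⟩ := isSiegelRoot_iff.1 h
  have h1 : x ≤ 1 := by
    by_contra! h'
    exact (siegelFun_pos h'.le).ne' h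
  constructor
  · refine (strictMonoOn_siegelFun.lt_iff_lt ⟨by norm_num, by norm_num⟩ ⟨h0, h1⟩).1 ?_
    rw [h]; exact siegelFun_lower_neg
  · refine (strictMonoOn_siegelFun.lt_iff_lt ⟨h0, h1⟩ ⟨by norm_num, by norm_num⟩).1 ?_
    rw [h]; exact siegelFun_upper_pos

theorem exp_one_mul_rpow_eq {x : ℝ} (hx : 0 < x) : Real.exp 1 * (1 + x⁻¹) ^ (-x) =
    Real.exp (1 - x * (Real.log (1 + x) - Real.log x)) := by
  rw [Real.rpow_def_of_pos (by positivity), ← Real.exp_add, log_one_add_inv hx]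
  congr 1
  ring

theorem IsSiegelRoot.bounds {x : ℝ} (h : IsSiegelRoot x) :
    1.7336105 ≤ Real.exp 1 * (1 + x⁻¹) ^ (-x) ∧ Real.exp 1 * (1 + x⁻¹) ^ (-x) < 1.7336106 := by
  obtain ⟨h1, h2⟩ := h.mem_Ioo
  rw [exp_one_mul_rpow_eq h.1, ← Real.log_le_iff_le_exp (by norm_num),
    ← Real.lt_log_iff_exp_lt (by norm_num)]
  have m1 := strictMonoOn_mul_log_sub_log (a := 0.31448084) (mem_Ioi.2 (by norm_num)) h.1 h1
  have m2 := strictMonoOn_mul_log_sub_log h.1 (b := 0.314480876) (mem_Ioi.2 (by norm_num)) h2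
  simp only at m1 m2
  constructor
  · have A := (log_div_bounds (y := (1.314480876 - 1.257923504) / (1.314480876 + 1.257923504))
      (by norm_num) (by norm_num)).2
    have B := (log_div_bounds (y := (2 - 1.7336105) / (2 + 1.7336105)) (by norm_num)
      (by norm_num)).1
    have e2 : Real.log 1.7336105 = Real.log 2 - Real.log
        ((1 + (2 - 1.7336105) / (2 + 1.7336105)) / (1 - (2 - 1.7336105) / (2 + 1.7336105))) := by
      rw [← Real.log_div (by norm_num) (by norm_num)]
      norm_num
    have hl := Real.log_two_lt_d9
    rw [log_sub_log_upper_eq] at m2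
    rw [e2]
    norm_num [Finset.sum_range_succ] at A B m2 ⊢
    linarith
  · have A := (log_div_bounds (y := (1.31448084 - 1.25792336) / (1.31448084 + 1.25792336))
      (by norm_num) (by norm_num)).1
    have B := (log_div_bounds (y := (2 - 1.7336106) / (2 + 1.7336106)) (by norm_num)
      (by norm_num)).2
    have e2 : Real.log 1.7336106 = Real.log 2 - Real.log
        ((1 + (2 - 1.7336106) / (2 + 1.7336106)) / (1 - (2 - 1.7336106) / (2 + 1.7336106))) := by
      rw [← Real.log_div (by norm_num) (by norm_num)]
      norm_num
    have hl := Real.log_two_gt_d9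
    rw [log_sub_log_lower_eq] at m1
    rw [e2]
    norm_num [Finset.sum_range_succ] at A B m1 ⊢
    linarith

/-- The definition of `T` and Siegel's equation, as linear relations between logarithms. -/
theorem IsSiegelRoot.log_relations {x T : ℝ} (h : IsSiegelRoot x)
    (hT : T = Real.exp 1 * (1 + x⁻¹) ^ (-x)) :
    Real.log T = 1 - x * (Real.log (1 + x) - Real.log x) ∧
      (x + 2) * Real.log T = Real.log (1 + x) + 1 := by
  obtain ⟨h0, h⟩ := isSiegelRoot_iff.1 h
  have e : Real.log T = 1 - x * (Real.log (1 + x) - Real.log x) := by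
    rw [hT, exp_one_mul_rpow_eq h0, Real.log_exp]
  refine ⟨e, ?_⟩
  rw [e]
  unfold siegelFun at h
  field_simp at h
  linarith

/-! ### Optimality of Siegel's measure -/

/-- The conditions on the parameters `T` and `r = (ν + 1)^(-1/2)` under which Siegel's measure is
optimal: the two logarithmic relations make its energy and its integral of `log x` vanish. -/
structure SiegelParameters (T r : ℝ) : Prop where
  T_pos : 0 < T
  r_pos : 0 < r
  r_lt_one : r < 1
  energy : (1 + r ^ 2) * Real.log T + 2 * r ^ 2 * Real.log r = r ^ 2
  logIntegral : Real.log T = 1 + (1 - r ^ 2) / r ^ 2 * Real.log (1 - r ^ 2)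

theorem IsSiegelRoot.siegelParameters {x T : ℝ} (h : IsSiegelRoot x)
    (hT : T = Real.exp 1 * (1 + x⁻¹) ^ (-x)) : SiegelParameters T (1 / Real.sqrt (x + 1)) := by
  have hx : 0 < x := h.1
  obtain ⟨e1, e2⟩ := h.log_relations hT
  have hsq : (1 / Real.sqrt (x + 1)) ^ 2 = 1 / (x + 1) := by
    rw [div_pow, Real.sq_sqrt (by linarith), one_pow]
  have hs1 : 1 < Real.sqrt (x + 1) := by
    rw [Real.lt_sqrt (by norm_num)]; linarith
  have hs0 : 0 < Real.sqrt (x + 1) := by linarith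
  refine ⟨by rw [hT, exp_one_mul_rpow_eq hx]; exact Real.exp_pos _, by positivity,
    by rw [div_lt_one hs0]; exact hs1, ?_, ?_⟩
  · rw [hsq, one_div (Real.sqrt _), Real.log_inv, Real.log_sqrt (by linarith)]
    rw [add_comm 1 x] at e2
    field_simp
    linear_combination e2
  · rw [hsq]
    have : 1 - 1 / (x + 1) = x / (1 + x) := by field_simp; ring
    rw [this, Real.log_div hx.ne' (by linarith), e1]
    field_simp
    ring

/-- Siegel's measure in the parameters `T` and `r`. -/
abbrev siegelLaw (T r : ℝ) : Measure ℝ := siegelMeasure (T * (1 - r) ^ 2) (T * (1 + r) ^ 2)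

namespace SiegelParameters

theorem isProbabilityMeasure (h : SiegelParameters T r) : IsProbabilityMeasure (siegelLaw T r) :=
  isProbabilityMeasure_siegelMeasure h.T_pos h.r_pos h.r_lt_one

theorem one_sub_sq_pos (h : SiegelParameters T r) : 0 < 1 - r ^ 2 := by
  nlinarith [h.r_pos, h.r_lt_one]

theorem integrable_id (h : SiegelParameters T r) :
    Integrable (fun x : ℝ => x) (siegelLaw T r) :=
  integrable_id_siegelMeasure h.T_pos h.r_pos h.r_lt_one

theorem left_endpoint_pos (h : SiegelParameters T r) : 0 < T * (1 - r) ^ 2 := by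
  have := h.T_pos
  have : 0 < 1 - r := sub_pos.2 h.r_lt_one
  positivity

theorem integrable_log_sub (h : SiegelParameters T r) (x : ℝ) :
    (∀ᵐ y ∂(siegelLaw T r), x - y ≠ 0) ∧
      Integrable (fun y => Real.log |x - y|) (siegelLaw T r) := by
  have := h.isProbabilityMeasure
  obtain ⟨C, hC, hle⟩ := siegelMeasure_le h.T_pos h.r_pos h.r_lt_one
  exact integrable_log_sub_left h.integrable_id hC hle x

theorem integrable_log_sub_prod (h : SiegelParameters T r) {μ : Measure ℝ}
    [IsProbabilityMeasure μ] (hμ : Integrable (fun x : ℝ => x) μ) :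
    (∀ᵐ p ∂(μ.prod (siegelLaw T r)), p.1 ≠ p.2) ∧
      Integrable (fun p : ℝ × ℝ => Real.log |p.1 - p.2|) (μ.prod (siegelLaw T r)) := by
  have := h.isProbabilityMeasure
  obtain ⟨C, hC, hle⟩ := siegelMeasure_le h.T_pos h.r_pos h.r_lt_one
  exact _root_.integrable_log_sub_prod hμ h.integrable_id hC hle

theorem integrable_log (h : SiegelParameters T r) :
    (∀ᵐ x ∂(siegelLaw T r), x ≠ 0) ∧ Integrable (fun x => Real.log |x|) (siegelLaw T r) := by
  simpa using h.integrable_log_sub 0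

theorem integral_log (h : SiegelParameters T r) : ∫ x, Real.log |x| ∂(siegelLaw T r) = 0 :=
  integral_log_siegelMeasure h.T_pos h.r_pos h.r_lt_one h.logIntegral

theorem equality (h : SiegelParameters T r) {x : ℝ}
    (hx : x ∈ Icc (T * (1 - r) ^ 2) (T * (1 + r) ^ 2)) :
    T + T * (1 - r ^ 2) * Real.log |x| + 2 * r ^ 2 * T *
      ∫ y, Real.log |x - y| ∂(siegelLaw T r) = x := by
  rw [Real.log_abs]
  exact siegelMeasure_equality h.T_pos h.r_pos h.r_lt_one h.energy hx

theorem inequality (h : SiegelParameters T r) {x : ℝ} (hx : 0 < x) :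
    T + T * (1 - r ^ 2) * Real.log |x| + 2 * r ^ 2 * T *
      ∫ y, Real.log |x - y| ∂(siegelLaw T r) ≤ x := by
  rw [Real.log_abs]
  exact siegelMeasure_inequality h.T_pos h.r_pos h.r_lt_one h.energy hx

theorem integral_id (h : SiegelParameters T r) : ∫ x, x ∂(siegelLaw T r) = T :=
  integral_id_siegelMeasure h.T_pos h.r_pos h.r_lt_one

/-- The energy vanishes: integrate the equality on the support. -/
theorem energy_eq_zero (h : SiegelParameters T r) :
    ∫ p, Real.log |p.1 - p.2| ∂((siegelLaw T r).prod (siegelLaw T r)) = 0 := by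
  have := h.isProbabilityMeasure
  have hi := (h.integrable_log_sub_prod h.integrable_id).2
  rw [integral_prod _ hi]
  have hU := hi.integral_prod_left
  have e : ∫ x, (T + T * (1 - r ^ 2) * Real.log |x| + 2 * r ^ 2 * T *
      ∫ y, Real.log |x - y| ∂(siegelLaw T r)) ∂(siegelLaw T r) = ∫ x, x ∂(siegelLaw T r) :=
    integral_congr_ae (by
      filter_upwards [ae_mem_Icc_siegelMeasure (T * (1 - r) ^ 2) (T * (1 + r) ^ 2)] with x hx
      exact h.equality hx)
  have i1 : Integrable (fun x => T + T * (1 - r ^ 2) * Real.log |x|) (siegelLaw T r) :=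
    (integrable_const T).add (h.integrable_log.2.const_mul _)
  rw [integral_add i1 (hU.const_mul _), integral_add (integrable_const T)
    (h.integrable_log.2.const_mul _), integral_const_mul, integral_const_mul, h.integral_log,
    h.integral_id] at e
  simp only [integral_const, probReal_univ, one_smul, mul_zero, add_zero] at e
  have hpos : 2 * r ^ 2 * T ≠ 0 := by
    have := h.T_pos; have := h.r_pos; positivity
  have : 2 * r ^ 2 * T * ∫ x, ∫ y, Real.log |x - y| ∂(siegelLaw T r) ∂(siegelLaw T r) = 0 := by
    linarith
  exact (mul_eq_zero.1 this).resolve_left hpos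

theorem nonneg_support (h : SiegelParameters T r) : siegelLaw T r (Iio 0) = 0 := by
  have hsub : Iio 0 ⊆ (Icc (T * (1 - r) ^ 2) (T * (1 + r) ^ 2))ᶜ := fun x hx hmem =>
    absurd (h.left_endpoint_pos.trans_le hmem.1) (not_lt.2 (le_of_lt hx))
  exact measure_mono_null hsub (siegelMeasure_compl _ _)

theorem meanValue_eq (h : SiegelParameters T r) : meanValue (siegelLaw T r) = ENNReal.ofReal T := by
  have hae : ∀ᵐ x ∂(siegelLaw T r), 0 ≤ x := by
    filter_upwards [ae_mem_Icc_siegelMeasure (T * (1 - r) ^ 2) (T * (1 + r) ^ 2)] with x hx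
    exact h.left_endpoint_pos.le.trans hx.1
  rw [meanValue, ← ofReal_integral_eq_lintegral_ofReal h.integrable_id hae, h.integral_id]

theorem logEnergy_eq (h : SiegelParameters T r) : logEnergy (siegelLaw T r) = 0 := by
  have := h.isProbabilityMeasure
  obtain ⟨h1, h2⟩ := h.integrable_log_sub_prod h.integrable_id
  rw [logEnergy, extIntegral_extLogAbs (h1.mono fun p hp => sub_ne_zero.2 hp) h2, h.energy_eq_zero]
  rfl

theorem logIntegral_X_eq (h : SiegelParameters T r) : _root_.logIntegral (siegelLaw T r) X = 0 := by
  simp only [_root_.logIntegral, eval_X]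
  rw [extIntegral_extLogAbs h.integrable_log.1 h.integrable_log.2, h.integral_log]
  rfl

theorem isFeasible (h : SiegelParameters T r) : IsFeasible {(X : ℝ[X])} (siegelLaw T r) where
  isProbability := h.isProbabilityMeasure
  nonneg_support := h.nonneg_support
  energy_nonneg := h.logEnergy_eq.ge
  logIntegral_nonneg Q hQ := by
    rw [Finset.mem_singleton.1 hQ]; exact h.logIntegral_X_eq.ge

/-- A measure of finite mean and nonnegative energy has nonnegative mutual energy with Siegel's
measure, and equals it when both vanish. -/
theorem mutual_energy (h : SiegelParameters T r) {μ : Measure ℝ} [IsProbabilityMeasure μ]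
    (hμ : Integrable (fun x : ℝ => x) μ) (hE : 0 ≤ logEnergy μ) :
    0 ≤ ∫ p, Real.log |p.1 - p.2| ∂(μ.prod (siegelLaw T r)) ∧
      (∫ p, Real.log |p.1 - p.2| ∂(μ.prod (siegelLaw T r)) ≤ 0 → μ = siegelLaw T r) := by
  have := h.isProbabilityMeasure
  obtain ⟨a1, b1⟩ := integrable_log_of_extIntegral_nonneg (h := fun p : ℝ × ℝ => p.1 - p.2)
    (by fun_prop) (lintegral_posLog_sub_ne_top hμ hμ) hE
  obtain ⟨a2, b2⟩ := h.integrable_log_sub_prod h.integrable_id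
  obtain ⟨a3, b3⟩ := h.integrable_log_sub_prod hμ
  rw [logEnergy, extIntegral_extLogAbs a1 b1, EReal.coe_nonneg] at hE
  obtain ⟨h1, h2⟩ := log_energy_le μ (siegelLaw T r) (a1.mono fun p hp => sub_ne_zero.1 hp)
    a2 a3 b1 b2 b3
  rw [h.energy_eq_zero] at h1 h2
  exact ⟨by linarith, fun hle => h2 (by linarith)⟩

/-- The lower bound for the mean of a feasible measure, obtained by integrating the pointwise
inequality for Siegel's measure, with the case of equality. -/
theorem le_meanValue (h : SiegelParameters T r) {μ : Measure ℝ}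
    (hμ : IsFeasible {(X : ℝ[X])} μ) :
    ENNReal.ofReal T ≤ meanValue μ ∧ (meanValue μ = ENNReal.ofReal T → μ = siegelLaw T r) := by
  have := hμ.isProbability
  have := h.isProbabilityMeasure
  by_cases htop : meanValue μ = ⊤
  · rw [htop]
    exact ⟨le_top, fun h' => absurd h'.symm ENNReal.ofReal_ne_top⟩
  obtain ⟨hid, hmean, hmean0⟩ := integrable_id_of_meanValue_ne_top hμ.nonneg_support htop
  obtain ⟨k1, k2⟩ := h.mutual_energy hid hμ.energy_nonneg
  have hi := (h.integrable_log_sub_prod hid).2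
  have hlog := hμ.logIntegral_nonneg X (Finset.mem_singleton_self _)
  simp only [_root_.logIntegral, eval_X] at hlog
  have hfin : ∫⁻ x, ENNReal.ofReal (Real.log |x|) ∂μ ≠ ⊤ :=
    ne_top_of_le_ne_top hid.abs.lintegral_lt_top.ne
      (lintegral_mono fun x => ENNReal.ofReal_le_ofReal (Real.log_le_self (abs_nonneg _)))
  obtain ⟨l1, l2⟩ := integrable_log_of_extIntegral_nonneg (h := fun x : ℝ => x)
    measurable_id hfin hlog
  rw [extIntegral_extLogAbs l1 l2, EReal.coe_nonneg] at hlog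
  -- the condition on `∫ log x` excludes an atom at `0`
  have hpos : ∀ᵐ x ∂μ, 0 < x := by
    have : ∀ᵐ x ∂μ, x ∉ Iio (0 : ℝ) := measure_eq_zero_iff_ae_notMem.1 hμ.nonneg_support
    filter_upwards [this, l1] with x hx hx0
    exact lt_of_le_of_ne (not_lt.1 hx) (Ne.symm hx0)
  have i1 : Integrable (fun x => T + T * (1 - r ^ 2) * Real.log |x|) μ :=
    (integrable_const T).add (l2.const_mul _)
  have hU := hi.integral_prod_left
  have key : ∫ x, (T + T * (1 - r ^ 2) * Real.log |x| + 2 * r ^ 2 * T *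
      ∫ y, Real.log |x - y| ∂(siegelLaw T r)) ∂μ ≤ ∫ x, x ∂μ :=
    integral_mono_ae (i1.add (hU.const_mul _)) hid (hpos.mono fun x hx => h.inequality hx)
  rw [integral_add i1 (hU.const_mul _), integral_add (integrable_const T) (l2.const_mul _),
    integral_const_mul, integral_const_mul, ← integral_prod _ hi] at key
  simp only [integral_const, probReal_univ, one_smul] at key
  have hc : 0 ≤ T * (1 - r ^ 2) * ∫ x, Real.log |x| ∂μ :=
    mul_nonneg (mul_nonneg h.T_pos.le h.one_sub_sq_pos.le) hlog
  have hc0 : 0 < 2 * r ^ 2 * T := by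
    have := h.T_pos; have := h.r_pos; positivity
  have hm := mul_nonneg hc0.le k1
  rw [hmean]
  refine ⟨ENNReal.ofReal_le_ofReal (by linarith), fun heq => k2 ?_⟩
  rw [ENNReal.ofReal_eq_ofReal_iff hmean0 h.T_pos.le] at heq
  by_contra! hlt
  have := mul_pos hc0 hlt
  linarith

theorem traceBound_eq (h : SiegelParameters T r) :
    traceBound {(X : ℝ[X])} = ENNReal.ofReal T :=
  le_antisymm (iInf₂_le_of_le _ h.isFeasible h.meanValue_eq.le)
    (le_iInf₂ fun _ hμ => (h.le_meanValue hμ).1)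

theorem coe_traceBound (h : SiegelParameters T r) :
    ((traceBound {(X : ℝ[X])} : ℝ≥0∞) : EReal) = (T : EReal) := by
  rw [h.traceBound_eq, EReal.coe_ennreal_ofReal, max_eq_left h.T_pos.le]

theorem logPotential_eq (h : SiegelParameters T r) (x : ℝ) :
    logPotential (siegelLaw T r) x = ((∫ y, Real.log |x - y| ∂(siegelLaw T r) : ℝ) : EReal) :=
  extIntegral_extLogAbs (h.integrable_log_sub x).1 (h.integrable_log_sub x).2

theorem isOptimalMeasure (h : SiegelParameters T r) (hT : T ≤ 4) :
    IsOptimalMeasure {(X : ℝ[X])} (siegelLaw T r) := by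
  have h0 := h.r_pos
  have h1 := h.r_lt_one
  have hTp := h.T_pos
  have hlt : T * (1 - r) ^ 2 < T * (1 + r) ^ 2 := by nlinarith [mul_pos hTp h0]
  refine ⟨h.isProbabilityMeasure, Icc (T * (1 - r) ^ 2) (T * (1 + r) ^ 2),
    ⟨{(T * (1 - r) ^ 2, T * (1 + r) ^ 2)}, by simpa using hlt, by simp⟩,
    Icc_subset_Icc h.left_endpoint_pos.le (by nlinarith), siegelMeasure_compl _ _,
    by rw [h.meanValue_eq, h.traceBound_eq], h.logEnergy_eq,
    fun _ => T * (1 - r ^ 2), 2 * r ^ 2 * T, fun _ _ => mul_nonneg hTp.le h.one_sub_sq_pos.le,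
    by positivity, fun x hx => ?_, fun x hx => ?_, fun Q hQ _ => ?_⟩
  · rw [Finset.sum_singleton, eval_X, h.coe_traceBound, h.logPotential_eq]
    -- at `x = 0` the term `log 0 = ⊥` has a positive coefficient and the potential is finite
    rcases hx.eq_or_lt with rfl | hx
    · rw [extLogAbs_zero, EReal.coe_mul_bot_of_pos (mul_pos hTp h.one_sub_sq_pos)]
      simp
    · rw [extLogAbs_of_ne_zero hx.ne']
      exact_mod_cast h.inequality hx
  · rw [Finset.sum_singleton, eval_X, h.coe_traceBound, h.logPotential_eq,
      extLogAbs_of_ne_zero (h.left_endpoint_pos.trans_le hx.1).ne']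
    exact_mod_cast h.equality hx
  · rw [Finset.mem_singleton.1 hQ]; exact h.logIntegral_X_eq

/-- Integrating the defining inequality of an optimal measure against Siegel's measure gives a
nonpositive mutual energy. -/
theorem eq_of_isOptimalMeasure (h : SiegelParameters T r) {μ : Measure ℝ}
    (hμ : IsOptimalMeasure {(X : ℝ[X])} μ) : μ = siegelLaw T r := by
  obtain ⟨hprob, S, -, hS, hSc, hmean, hE, c, c₀, -, hc₀, hle, -, -⟩ := hμ
  have := h.isProbabilityMeasure
  have hsub : Iio 0 ⊆ Sᶜ := fun x hx hmem => absurd (hS hmem).1 (not_le.2 hx)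
  have hneg : μ (Iio 0) = 0 := measure_mono_null hsub hSc
  obtain ⟨hid, -, -⟩ := integrable_id_of_meanValue_ne_top hneg
    (by rw [hmean, h.traceBound_eq]; exact ENNReal.ofReal_ne_top)
  refine (h.mutual_energy hid hE.ge).2 ?_
  obtain ⟨a3, b3⟩ := h.integrable_log_sub_prod hid
  have e1 : (fun p : ℝ × ℝ => Real.log |p.1 - p.2|) ∘ Prod.swap =
      fun p : ℝ × ℝ => Real.log |p.1 - p.2| := by
    funext p
    simp only [Function.comp, Prod.fst_swap, Prod.snd_swap]
    rw [abs_sub_comm]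
  have b4 : Integrable (fun p : ℝ × ℝ => Real.log |p.1 - p.2|) ((siegelLaw T r).prod μ) := by
    have := b3.swap
    rwa [e1] at this
  have a4 : ∀ᵐ x ∂(siegelLaw T r), ∀ᵐ y ∂μ, x - y ≠ 0 := by
    have hs : MeasurableSet {p : ℝ × ℝ | p.1 ≠ p.2} :=
      (measurableSet_eq_fun measurable_fst measurable_snd).compl
    have := Measure.ae_ae_comm (μ := μ) (ν := siegelLaw T r) (p := fun x y => x ≠ y) hs
    refine (this.1 (Measure.ae_ae_of_ae_prod a3)).mono fun x hx => hx.mono fun y hy => ?_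
    exact sub_ne_zero.2 hy.symm
  have e2 : ∫ p, Real.log |p.1 - p.2| ∂(μ.prod (siegelLaw T r)) =
      ∫ x, ∫ y, Real.log |x - y| ∂μ ∂(siegelLaw T r) := by
    rw [← integral_prod _ b4, ← integral_prod_swap]
    refine integral_congr_ae (Eventually.of_forall fun p => ?_)
    exact congrFun e1 p
  have hae : ∀ᵐ x ∂(siegelLaw T r), T + c X * Real.log |x| + c₀ * ∫ y, Real.log |x - y| ∂μ ≤ x := by
    filter_upwards [a4, b4.prod_right_ae,
      ae_mem_Icc_siegelMeasure (T * (1 - r) ^ 2) (T * (1 + r) ^ 2)] with x hx1 hx2 hx3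
    have hx0 : 0 < x := h.left_endpoint_pos.trans_le hx3.1
    have := hle x hx0.le
    rw [Finset.sum_singleton, eval_X, h.coe_traceBound, extLogAbs_of_ne_zero hx0.ne',
      show logPotential μ x = _ from extIntegral_extLogAbs hx1 hx2] at this
    exact_mod_cast this
  have i1 : Integrable (fun x => T + c X * Real.log |x|) (siegelLaw T r) :=
    (integrable_const T).add (h.integrable_log.2.const_mul _)
  have hU := b4.integral_prod_left
  have key := integral_mono_ae (i1.add (hU.const_mul c₀)) h.integrable_id hae
  have e3 := integral_add i1 (hU.const_mul c₀)
  simp only [Pi.add_apply] at key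
  rw [e3, integral_add (integrable_const T) (h.integrable_log.2.const_mul _),
    integral_const_mul, integral_const_mul, h.integral_log, h.integral_id, ← e2] at key
  simp only [integral_const, probReal_univ, one_smul, mul_zero, add_zero] at key
  by_contra! hlt
  have := mul_pos hc₀ hlt
  linarith

end SiegelParameters

end

theorem corollary1p4 :
    (∃! ν : ℝ, IsSiegelRoot ν) ∧
    ∀ ν T a b : ℝ, IsSiegelRoot ν →
      T = Real.exp 1 * (1 + ν⁻¹) ^ (-ν) →
      a = T * (1 - 1 / Real.sqrt (ν + 1)) ^ 2 →
      b = T * (1 + 1 / Real.sqrt (ν + 1)) ^ 2 →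
      traceBound {(X : ℝ[X])} = ENNReal.ofReal T ∧
      1.7336105 ≤ T ∧ T < 1.7336106 ∧
      (∀ μ : Measure ℝ, IsOptimalMeasure {(X : ℝ[X])} μ ↔ μ = siegelMeasure a b) ∧
      (∀ μ : Measure ℝ,
        (IsFeasible {(X : ℝ[X])} μ ∧ meanValue μ = traceBound {(X : ℝ[X])}) ↔
          μ = siegelMeasure a b) := by
  refine ⟨existsUnique_isSiegelRoot, fun ν T a b hν hT ha hb => ?_⟩
  have h := hν.siegelParameters hT
  have hbd := hν.bounds
  rw [← hT] at hbd
  have hσ : siegelMeasure a b = siegelLaw T (1 / Real.sqrt (ν + 1)) := by rw [ha, hb]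
  rw [hσ]
  refine ⟨h.traceBound_eq, hbd.1, hbd.2, fun μ => ⟨h.eq_of_isOptimalMeasure, ?_⟩,
    fun μ => ⟨fun hμ => (h.le_meanValue hμ.1).2 (hμ.2.trans h.traceBound_eq), ?_⟩⟩
  · rintro rfl
    exact h.isOptimalMeasure (hbd.2.le.trans (by norm_num))
  · rintro rfl
    exact ⟨h.isFeasible, h.meanValue_eq.trans h.traceBound_eq.symm⟩
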